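/- Let $n\ge 2$, $1<p<\infty$ and $\lambda\in(0,1)$. Write $x=(x',x_n)\in\mathbb{R}^{n-1}\times\mathbb{R}$, $H_t=\{x\in\mathbb{R}^n:x_n=t\}$, $\nabla'=(\partial_1,\dots,\partial_{n-1})$ and $a\otimes b=ab^T$. Let $Y=(0,1]^n$, $Y_{\rm soft}=(0,1]^{n-1}\times(0,\lambda)$ and $Y_{\rm stiff}=Y\setminus Y_{\rm soft}$, where $Y_{\rm soft}$ and $Y_{\rm stiff}$ are identified with their $Y$-periodic extensions to $\mathbb{R}^n$. Let $\Omega\subset\mathbb{R}^n$ be a bounded Lipschitz domain (open and connected) that is flat, i.e. for every $t\in\mathbb{R}$ the set $\overline\Omega\cap H_t$ is empty or has nonempty interior relative to $H_t$, and cross-section connected, i.e. $\Omega\cap H_t$ is connected (possibly empty) for every $t\in\mathbb{R}$. Let $u\in W^{1,p}(\Omega;\mathbb{R}^n)$ satisfy $$\nabla u(x)=R(x)+(\partial_nR)(x)\,x\otimes e_n+d(x)\otimes e_n\quad\text{for a.e. }x\in\Omega,$$ where $R\in W^{1,p}(\Omega;SO(n))$ with $\nabla'R=0$ and $d\in L^p(\Omega;\mathbb{R}^n)$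 with $\nabla'd=0$ in the sense of distributions, and set $$(\nabla u)_\lambda(x)=R(x)+\tfrac1\lambda(\partial_nR)(x)\,x\otimes e_n+\tfrac1\lambda d(x)\otimes e_n .$$ Then there exist $(u_\varepsilon)_{\varepsilon>0}\subset W^{1,p}(\Omega;\mathbb{R}^n)$ and $(R_\varepsilon)_{\varepsilon>0}\subset W^{1,p}(\Omega;SO(n))$ such that, for every $\varepsilon>0$, $\nabla'R_\varepsilon=0$ on $\Omega$, $\partial_nR_\varepsilon=0$ a.e. in $\varepsilon Y_{\rm stiff}\cap\Omega$, and $$\nabla u_\varepsilon=R_\varepsilon\in SO(n)\quad\text{a.e. in }\varepsilon Y_{\rm stiff}\cap\Omega ,$$ and such that, as $\varepsilon\to0$, $u_\varepsilon\rightharpoonup u$ in $W^{1,p}(\Omega;\mathbb{R}^n)$ (in particular $\nabla u_\varepsilon\rightharpoonup\nabla u$ in $L^p(\Omega;\mathbb{R}^{n\times n})$), $R_\varepsilon\rightharpoonup R$ in $W^{1,p}(\Omega;\mathbb{R}^{n\times n})$, and $$\|\nabla u_\varepsilon-(\nabla u)_\lambda\|_{L^p(\varepsilon Y_{\rm soft}\cap\Omega;\mathbb{R}^{n\times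 n})}\to0 .$$ -/

import Mathlib

open MeasureTheory Set Filter Topology
open scoped ContDiff Matrix ENNReal

/-- The space `ℝⁿ` with `n = m + 1` and its Euclidean norm; the distinguished direction `e_n` belongs
to the index `Fin.last m`. -/
abbrev Space (m : ℕ) : Type := EuclideanSpace ℝ (Fin (m + 1))

/-- Real `n × n` matrices, `n = m + 1`. -/
abbrev Mat (m : ℕ) : Type := Matrix (Fin (m + 1)) (Fin (m + 1)) ℝ

/-- The first `n - 1` coordinates `x'` of `x = (x', x_n)`. -/
def horizontal {m : ℕ} (x : Space m) : EuclideanSpace ℝ (Fin m) :=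
  WithLp.toLp 2 (fun i : Fin m => x i.castSucc)

/-- The hyperplane `H_t = {x : x_n = t}`. -/
def hyperplane (m : ℕ) (t : ℝ) : Set (Space m) := {x | x (Fin.last m) = t}

/-- A bounded Lipschitz domain: a bounded, open, connected set which near each of its boundary points
is, after an orthogonal change of coordinates, the region strictly above the graph of a Lipschitz
function of `n - 1` variables. -/
structure IsBoundedLipschitzDomain {m : ℕ} (Ω : Set (Space m)) : Prop where
  isBounded : Bornology.IsBounded Ω
  isOpen : IsOpen Ω
  isConnected : IsConnected Ω
  boundary : ∀ x₀ ∈ frontier Ω, ∃ (A : Space m ≃ₗᵢ[ℝ] Space m) (γ : EuclideanSpace ℝ (Fin m) → ℝ)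
    (K : NNReal) (r : ℝ), LipschitzWith K γ ∧ 0 < r ∧
      ∀ x ∈ Metric.ball x₀ r, x ∈ Ω ↔ γ (horizontal (A x)) < A x (Fin.last m)

/-- Every cross section `Ω ∩ H_t` is connected (the empty set counts as connected here). -/
def IsCrossSectionConnected {m : ℕ} (Ω : Set (Space m)) : Prop :=
  ∀ t : ℝ, IsPreconnected (Ω ∩ hyperplane m t)

/-- For every `t`, the set `closure Ω ∩ H_t` is empty or has nonempty interior relative to `H_t`. -/
def IsFlat {m : ℕ} (Ω : Set (Space m)) : Prop :=
  ∀ t : ℝ, closure Ω ∩ hyperplane m t = ∅ ∨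
    ∃ V : Set (Space m), IsOpen V ∧ (V ∩ hyperplane m t).Nonempty ∧ V ∩ hyperplane m t ⊆ closure Ω

/-- The periodicity cell `Y = (0,1]ⁿ`. -/
def cell (m : ℕ) : Set (Space m) := {y | ∀ i, y i ∈ Ioc (0 : ℝ) 1}

/-- `Y_soft = (0,1]ⁿ⁻¹ × (0,λ)`. -/
def softCell (m : ℕ) (lam : ℝ) : Set (Space m) :=
  {y | (∀ i : Fin m, y i.castSucc ∈ Ioc (0 : ℝ) 1) ∧ y (Fin.last m) ∈ Ioo 0 lam}

/-- `Y_stiff = Y \ Y_soft`. -/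
def stiffCell (m : ℕ) (lam : ℝ) : Set (Space m) := cell m \ softCell m lam

/-- The `Y`-periodic extension `⋃_{k ∈ ℤⁿ} (k + A)` of a set `A ⊆ Y`. -/
def periodicExtension {m : ℕ} (A : Set (Space m)) : Set (Space m) :=
  {x | ∃ k : Fin (m + 1) → ℤ, WithLp.toLp 2 (fun i => x i - (k i : ℝ)) ∈ A}

/-- The soft layers `ε Y_soft` in `ℝⁿ`. -/
def softLayers (m : ℕ) (lam ε : ℝ) : Set (Space m) :=
  (fun y => ε • y) '' periodicExtension (softCell m lam)

/-- The stiff layers `ε Y_stiff` in `ℝⁿ`. -/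
def stiffLayers (m : ℕ) (lam ε : ℝ) : Set (Space m) :=
  (fun y => ε • y) '' periodicExtension (stiffCell m lam)

/-- `g` is the weak (distributional) partial derivative `∂_j f` on the open set `Ω`. -/
def HasWeakPartial {m : ℕ} (Ω : Set (Space m)) (j : Fin (m + 1)) (f g : Space m → ℝ) : Prop :=
  LocallyIntegrableOn f Ω volume ∧ LocallyIntegrableOn g Ω volume ∧
    ∀ φ : Space m → ℝ, ContDiff ℝ ∞ φ → HasCompactSupport φ → tsupport φ ⊆ Ω →
      ∫ x in Ω, f x * fderiv ℝ φ x (EuclideanSpace.single j 1) = -∫ x in Ω, g x * φ x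

/-- `f ∈ W^{1,p}(Ω)`. Vector- and matrix-valued Sobolev functions are treated entrywise. -/
def MemW1p {m : ℕ} (Ω : Set (Space m)) (p : ℝ≥0∞) (f : Space m → ℝ) : Prop :=
  MemLp f p (volume.restrict Ω) ∧
    ∀ j, ∃ g : Space m → ℝ, HasWeakPartial Ω j f g ∧ MemLp g p (volume.restrict Ω)

/-- The matrix field `G` is the weak gradient of `u`, that is `G_{ij} = ∂_j u_i`. -/
def HasWeakGradient {m : ℕ} (Ω : Set (Space m)) (u : Space m → Space m) (G : Space m → Mat m) :
    Prop :=
  ∀ i j, HasWeakPartial Ω j (fun x => u x i) (fun x => G x i j)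

/-- Weak convergence `f_ε ⇀ f` in `L^p(Ω)`, `1 < p < ∞`, as `ε ↓ 0` of a family indexed by `ε > 0`:
convergence of the pairings with all functions of `L^q(Ω)`, `1/p + 1/q = 1`. -/
def WeakConvLp {m : ℕ} (Ω : Set (Space m)) (p : ℝ≥0∞) (fε : ℝ → Space m → ℝ) (f : Space m → ℝ) :
    Prop :=
  (∀ ε > 0, MemLp (fε ε) p (volume.restrict Ω)) ∧ MemLp f p (volume.restrict Ω) ∧
    ∀ q : ℝ≥0∞, p⁻¹ + q⁻¹ = 1 → ∀ g : Space m → ℝ, MemLp g q (volume.restrict Ω) →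
      Tendsto (fun ε => ∫ x in Ω, fε ε x * g x) (𝓝[>] 0) (𝓝 (∫ x in Ω, f x * g x))

/-- Weak convergence `f_ε ⇀ f` in `W^{1,p}(Ω)` as `ε ↓ 0`: the functions and all their weak partial
derivatives converge weakly in `L^p(Ω)`. -/
def WeakConvW1p {m : ℕ} (Ω : Set (Space m)) (p : ℝ≥0∞) (fε : ℝ → Space m → ℝ) (f : Space m → ℝ) :
    Prop :=
  WeakConvLp Ω p fε f ∧
    ∀ j, ∃ (gε : ℝ → Space m → ℝ) (g : Space m → ℝ),
      (∀ ε > 0, HasWeakPartial Ω j (fε ε) (gε ε)) ∧ HasWeakPartial Ω j f g ∧ WeakConvLp Ω p gε g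

/-- The Frobenius norm of a matrix. -/
noncomputable def frobNorm {m : ℕ} (A : Mat m) : ℝ := √(∑ i, ∑ j, A i j ^ 2)

/-- The matrix field `R(x) + c (S(x) x) ⊗ e_n + c d(x) ⊗ e_n`. With `S = ∂_n R`, the value `c = 1` gives
the limit gradient `∇u` and `c = 1/λ` gives `(∇u)_λ`. -/
noncomputable def layeredField {m : ℕ} (c : ℝ) (R S : Space m → Mat m) (d : Space m → Space m)
    (x : Space m) : Mat m :=
  R x + c • Matrix.vecMulVec (S x *ᵥ x.ofLp) (Pi.single (Fin.last m) 1)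
    + c • Matrix.vecMulVec (d x).ofLp (Pi.single (Fin.last m) 1)

/-!
On `Ω` everything in sight depends on the height `x_n` alone. A function whose horizontal weak
derivatives vanish is locally a function of the height, and since the cross sections are connected it is
so globally (`exists_ae_eq_comp_height`). Flatness bounds the areas of the cross sections below, also
near the lowest and highest points (`IsHeightInterval.exists_restrict_le`), so that the
one-dimensional profiles are `p`-integrable. Hence `R = P(x_n)` with `P` absolutely continuous, and
`u(x) = P(x_n) x + D(x_n)`, because both sides have the same weak gradient (`exists_isProfile`).

Let `θ_ε` be the primitive of `λ⁻¹ 1_soft`. It stays within `ε` of the identity, and it is constant on the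
stiff layers. The recovery sequence is obtained by slowing down the profiles:
`R_ε(x) = P(θ_ε(x_n))` and `u_ε(x) = P(θ_ε(x_n)) x + D(θ_ε(x_n))`. On stiff layers `P ∘ θ_ε` and `D ∘ θ_ε`
are constant, so `∇u_ε = R_ε` there; on soft layers the derivatives of the profiles are evaluated at
`θ_ε(x_n)` and multiplied by `λ⁻¹`.

The convergences rest on one fact: `θ_ε` carries the measure with density `θ_ε'` to Lebesgue measure
(`IsLayerMap.measurePreserving`). It gives the chain rule for `P ∘ θ_ε`, uniform `L^p` bounds on the
gradients, and, by density of continuous functions, `f ∘ θ_ε - f → 0` in `L^p` of the soft layers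
(`tendsto_eLpNorm_comp_layerMap_sub`), which is the strong convergence claimed on the soft part.
Since `u_ε → u` and `R_ε → R` in `L^p`, the bounded gradients converge weakly to the gradients of the limits
(`weakConvLp_of_hasWeakPartial`).
-/

/-! ### Layer maps of the line -/

/-- A reparametrisation of the line that moves points by at most `ε`, has constant speed `Λ` on the
set `A`, and stands still off `A`. -/
structure IsLayerMap (Λ ε : ℝ) (A : Set ℝ) (θ : ℝ → ℝ) : Prop where
  pos : 0 < Λ
  measurableSet : MeasurableSet A
  sub_eq : ∀ s t, θ t - θ s = ∫ r in s..t, A.indicator (fun _ => Λ) r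
  abs_sub_le : ∀ t, |θ t - t| ≤ ε

namespace IsLayerMap

variable {Λ ε : ℝ} {A : Set ℝ} {θ : ℝ → ℝ}

theorem intervalIntegrable (hθ : IsLayerMap Λ ε A θ) (s t : ℝ) :
    IntervalIntegrable (A.indicator (fun _ => Λ)) volume s t := by
  have h : IntervalIntegrable (fun _ : ℝ => Λ) volume s t := intervalIntegrable_const
  exact ⟨h.1.indicator hθ.measurableSet, h.2.indicator hθ.measurableSet⟩

theorem continuous (hθ : IsLayerMap Λ ε A θ) : Continuous θ := by
  have h := intervalIntegral.continuous_primitive (fun s t => hθ.intervalIntegrable s t) 0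
  have h2 : θ = fun t => θ 0 + ∫ r in (0 : ℝ)..t, A.indicator (fun _ => Λ) r := by
    ext t; rw [← hθ.sub_eq]; ring
  rw [h2]; exact continuous_const.add h

theorem monotone (hθ : IsLayerMap Λ ε A θ) : Monotone θ := by
  intro s t hst
  rw [← sub_nonneg, hθ.sub_eq]
  exact intervalIntegral.integral_nonneg hst fun r _ =>
    indicator_nonneg (fun _ _ => hθ.pos.le) r

/-- A half-line pulls back to a half-line whose endpoint lies over the given one. -/
theorem exists_preimage_Iic (hθ : IsLayerMap Λ ε A θ) (x : ℝ) :
    ∃ s, θ s = x ∧ θ ⁻¹' Iic x = Iic s := by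
  have hε : 0 ≤ ε := (abs_nonneg _).trans (hθ.abs_sub_le 0)
  obtain ⟨r, -, hr⟩ : x ∈ θ '' Icc (x - ε) (x + ε) := by
    refine intermediate_value_Icc (by linarith) hθ.continuous.continuousOn ⟨?_, ?_⟩
    · have := (abs_le.1 (hθ.abs_sub_le (x - ε))).2; linarith
    · have := (abs_le.1 (hθ.abs_sub_le (x + ε))).1; linarith
  have hbdd : BddAbove (θ ⁻¹' Iic x) := by
    refine ⟨x + ε, fun t ht => ?_⟩
    have h1 := (abs_le.1 (hθ.abs_sub_le t)).1
    have h2 : θ t ≤ x := ht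
    linarith
  have hne : (θ ⁻¹' Iic x).Nonempty := ⟨r, hr.le⟩
  have hmem := (isClosed_Iic.preimage hθ.continuous).csSup_mem hne hbdd
  refine ⟨sSup (θ ⁻¹' Iic x), le_antisymm hmem ?_, ?_⟩
  · exact hr.ge.trans (hθ.monotone (le_csSup hbdd hr.le))
  · ext t
    exact ⟨fun ht => le_csSup hbdd ht, fun ht => (hθ.monotone ht).trans hmem⟩

theorem smul_restrict_Ioc (hθ : IsLayerMap Λ ε A θ) {s t : ℝ} (hst : s ≤ t) :
    (ENNReal.ofReal Λ • volume.restrict A) (Ioc s t) = ENNReal.ofReal (θ t - θ s) := by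
  rw [hθ.sub_eq, intervalIntegral.integral_of_le hst, integral_indicator hθ.measurableSet,
    integral_const, Measure.smul_apply, Measure.restrict_apply measurableSet_Ioc, measureReal_def,
    Measure.restrict_apply_univ, Measure.restrict_apply hθ.measurableSet, inter_comm, smul_eq_mul,
    smul_eq_mul, mul_comm, ENNReal.ofReal_mul ENNReal.toReal_nonneg, ENNReal.ofReal_toReal]
  exact ((measure_mono inter_subset_right).trans_lt measure_Ioc_lt_top).ne

/-- The map `θ` carries the measure with density `θ' = Λ 1_A` to Lebesgue measure. -/
theorem measurePreserving (hθ : IsLayerMap Λ ε A θ) :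
    MeasurePreserving θ (ENNReal.ofReal Λ • volume.restrict A) volume := by
  refine ⟨hθ.continuous.measurable, Eq.symm ?_⟩
  refine Measure.ext_of_Ioc _ _ fun x y hxy => ?_
  obtain ⟨s, rfl, hs'⟩ := hθ.exists_preimage_Iic x
  obtain ⟨t, rfl, ht'⟩ := hθ.exists_preimage_Iic y
  have hst : s ≤ t := by
    by_contra h
    exact absurd (hθ.monotone (not_le.1 h).le) (not_le.2 hxy)
  have hpre : θ ⁻¹' Ioc (θ s) (θ t) = Ioc s t := by
    rw [← Iic_sdiff_Iic, preimage_sdiff, hs', ht', Iic_sdiff_Iic]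
  rw [Measure.map_apply hθ.continuous.measurable measurableSet_Ioc, hpre, hθ.smul_restrict_Ioc hst,
    Real.volume_Ioc]

theorem quasiMeasurePreserving (hθ : IsLayerMap Λ ε A θ) :
    Measure.QuasiMeasurePreserving θ (volume.restrict A) volume := by
  refine ⟨hθ.continuous.measurable, ?_⟩
  refine (Measure.AbsolutelyContinuous.map ?_ hθ.continuous.measurable).trans
    hθ.measurePreserving.map_eq.absolutelyContinuous
  exact Measure.AbsolutelyContinuous.rfl.smul_right (ENNReal.ofReal_pos.2 hθ.pos).ne'

/-- Substitution: `∫_s^t θ' (f ∘ θ) = ∫_{θ s}^{θ t} f`. -/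
theorem integral_comp (hθ : IsLayerMap Λ ε A θ) {f : ℝ → ℝ} (hf : AEStronglyMeasurable f volume)
    {s t : ℝ} (hst : s ≤ t) :
    ∫ r in s..t, A.indicator (fun r => Λ * f (θ r)) r = ∫ r in θ s..θ t, f r := by
  have hmp := hθ.measurePreserving
  set ν := ENNReal.ofReal Λ • volume.restrict A with hν
  have hnull : ∀ y, ∀ᵐ r ∂ν, θ r ≠ y := by
    intro y
    refine hmp.quasiMeasurePreserving.ae (p := fun z => z ≠ y) ?_
    exact Measure.ae_ne volume y
  have hset : (Ioc s t : Set ℝ) =ᵐ[ν] θ ⁻¹' Ioc (θ s) (θ t) := by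
    filter_upwards [hnull (θ s), hnull (θ t)] with r h1 h2
    refine propext ⟨fun hr => ⟨lt_of_le_of_ne (hθ.monotone hr.1.le) (Ne.symm h1),
      hθ.monotone hr.2⟩, fun hr => ⟨?_, ?_⟩⟩
    · by_contra h
      exact absurd hr.1 (not_lt.2 (hθ.monotone (not_lt.1 h)))
    · by_contra h
      exact h2 (le_antisymm hr.2 (hθ.monotone (not_le.1 h).le))
  have hmap : ∫ r in Ioc (θ s) (θ t), f r = ∫ r in θ ⁻¹' Ioc (θ s) (θ t), f (θ r) ∂ν := by
    rw [← setIntegral_map measurableSet_Ioc (by rwa [hmp.map_eq]) hmp.measurable.aemeasurable,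
      hmp.map_eq]
  rw [intervalIntegral.integral_of_le hst, intervalIntegral.integral_of_le (hθ.monotone hst),
    hmap, ← setIntegral_congr_set hset, hν, Measure.restrict_smul, integral_smul_measure,
    Measure.restrict_restrict measurableSet_Ioc, integral_indicator hθ.measurableSet,
    Measure.restrict_restrict hθ.measurableSet, inter_comm, integral_const_mul,
    ENNReal.toReal_ofReal hθ.pos.le, smul_eq_mul]

theorem eLpNorm_comp_le (hθ : IsLayerMap Λ ε A θ) (hΛ : 1 ≤ Λ) {f : ℝ → ℝ}
    (hf : AEStronglyMeasurable f volume) (p : ℝ≥0∞) :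
    eLpNorm (f ∘ θ) p (volume.restrict A) ≤ eLpNorm f p volume := by
  rw [← eLpNorm_comp_measurePreserving hf hθ.measurePreserving]
  refine eLpNorm_mono_measure _ ?_
  refine Measure.le_iff.2 fun s _ => ?_
  rw [Measure.smul_apply, smul_eq_mul]
  exact le_mul_of_one_le_left' (ENNReal.one_le_ofReal.2 hΛ)

theorem memLp_indicator_comp (hθ : IsLayerMap Λ ε A θ) (hΛ : 1 ≤ Λ) {f : ℝ → ℝ} {p : ℝ≥0∞}
    (hf : MemLp f p volume) : MemLp (A.indicator fun r => Λ * f (θ r)) p volume := by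
  rw [memLp_indicator_iff_restrict hθ.measurableSet]
  refine MemLp.const_mul (f := fun r => f (θ r)) ⟨?_, ?_⟩ Λ
  · exact hf.1.comp_quasiMeasurePreserving hθ.quasiMeasurePreserving
  · exact (hθ.eLpNorm_comp_le hΛ hf.1 p).trans_lt hf.2

theorem eLpNorm_indicator_comp_le (hθ : IsLayerMap Λ ε A θ) (hΛ : 1 ≤ Λ) {f : ℝ → ℝ}
    (hf : AEStronglyMeasurable f volume) (p : ℝ≥0∞) :
    eLpNorm (A.indicator fun r => Λ * f (θ r)) p volume ≤ ENNReal.ofReal Λ * eLpNorm f p volume := by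
  rw [eLpNorm_indicator_eq_eLpNorm_restrict hθ.measurableSet]
  calc eLpNorm (fun r => Λ * f (θ r)) p (volume.restrict A)
      = eLpNorm (Λ • (f ∘ θ)) p (volume.restrict A) := rfl
    _ = ‖Λ‖ₑ * eLpNorm (f ∘ θ) p (volume.restrict A) := eLpNorm_const_smul _ _ _ _
    _ ≤ _ := by
      rw [Real.enorm_of_nonneg hθ.pos.le]
      gcongr
      exact hθ.eLpNorm_comp_le hΛ hf p

end IsLayerMap

/-- Composition with layer maps close to the identity is close to the identity in `L^p` of the moving
layers: this is the continuity of translations in `L^p`, by density of `C_c`. -/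
theorem tendsto_eLpNorm_comp_layerMap_sub {Λ : ℝ} (hΛ : 1 ≤ Λ) {A : ℝ → Set ℝ} {θ : ℝ → ℝ → ℝ}
    (hθ : ∀ ε > 0, IsLayerMap Λ ε (A ε) (θ ε)) {p : ℝ≥0∞} (hp1 : 1 ≤ p) (hp2 : p ≠ ⊤)
    {f : ℝ → ℝ} (hf : MemLp f p volume) :
    Tendsto (fun ε => eLpNorm (f ∘ θ ε - f) p (volume.restrict (A ε))) (𝓝[>] 0) (𝓝 0) := by
  rw [ENNReal.tendsto_nhds_zero]
  intro δ hδ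
  obtain ⟨δ', hδ'0, hδ'⟩ : ∃ δ' : ℝ≥0∞, 0 < δ' ∧ δ' + δ' + δ' ≤ δ := by
    refine ⟨δ / 3, ENNReal.div_pos hδ.ne' (by simp), ?_⟩
    rw [ENNReal.add_thirds]
  obtain ⟨g, hgc, hfg, hgcont, hg⟩ := hf.exists_hasCompactSupport_eLpNorm_sub_le hp2 hδ'0.ne'
  -- `g ∘ θ - g` is supported in a fixed compact set and uniformly small
  set K := Metric.cthickening 1 (tsupport g) with hK
  have hKc : IsCompact K := hgc.isCompact.cthickening
  have hKtop : volume K ^ (1 / p.toReal) ≠ ⊤ := by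
    have : volume K ≠ ⊤ := hKc.measure_lt_top.ne
    exact ENNReal.rpow_ne_top_of_nonneg (by positivity) this
  obtain ⟨c, hc0, hc⟩ : ∃ c : ℝ, 0 < c ∧ ENNReal.ofReal c * volume K ^ (1 / p.toReal) ≤ δ' := by
    have : Tendsto (fun c : ℝ => ENNReal.ofReal c * volume K ^ (1 / p.toReal)) (𝓝[>] 0) (𝓝 0) := by
      have h0 : Tendsto (fun c : ℝ => ENNReal.ofReal c) (𝓝[>] 0) (𝓝 0) := by
        have := (ENNReal.continuous_ofReal.tendsto (0 : ℝ)).mono_left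
          (nhdsWithin_le_nhds (s := Ioi (0 : ℝ)))
        simpa using this
      simpa using ENNReal.Tendsto.mul_const h0 (Or.inr hKtop)
    obtain ⟨c, h1, h2⟩ := ((ENNReal.tendsto_nhds_zero.1 this δ' hδ'0).and
      self_mem_nhdsWithin).exists
    exact ⟨c, h2, h1⟩
  have huc : UniformContinuous g := hgcont.uniformContinuous_of_tendsto_cocompact
    hgc.is_zero_at_infty
  obtain ⟨η, hη0, hη⟩ := Metric.uniformContinuous_iff.1 huc c hc0
  filter_upwards [self_mem_nhdsWithin, Ioo_mem_nhdsGT (lt_min hη0 one_pos)] with ε hε0 hε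
  have hθε := hθ ε hε0
  have hεη : ε < η := hε.2.trans_le (min_le_left _ _)
  have hε1 : ε < 1 := hε.2.trans_le (min_le_right _ _)
  have e1 : f ∘ θ ε - f = ((f - g) ∘ θ ε + (g ∘ θ ε - g)) + (g - f) := by
    ext t; simp
  have hqm := hθε.quasiMeasurePreserving
  have m1 : AEStronglyMeasurable ((f - g) ∘ θ ε) (volume.restrict (A ε)) :=
    (hf.1.sub hg.1).comp_quasiMeasurePreserving hqm
  have m2 : AEStronglyMeasurable (g ∘ θ ε - g) (volume.restrict (A ε)) :=
    ((hgcont.comp hθε.continuous).sub hgcont).aestronglyMeasurable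
  have m3 : AEStronglyMeasurable (g - f) (volume.restrict (A ε)) := (hg.1.sub hf.1).restrict
  rw [e1]
  refine (eLpNorm_add_le (m1.add m2) m3 hp1).trans ?_
  refine (add_le_add_left (eLpNorm_add_le m1 m2 hp1) _).trans (le_trans ?_ hδ')
  gcongr
  · exact (hθε.eLpNorm_comp_le hΛ (hf.1.sub hg.1) p).trans hfg
  · refine (eLpNorm_mono_measure _ Measure.restrict_le_self).trans (le_trans ?_ hc)
    refine eLpNorm_sub_le_of_dist_bdd volume hp2 hKc.measurableSet hc0.le ?_ ?_ ?_
    · intro t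
      refine (hη ?_).le
      rw [Real.dist_eq]
      exact (hθε.abs_sub_le t).trans_lt hεη
    · intro t ht
      refine Metric.mem_cthickening_of_dist_le t (θ ε t) 1 _ (subset_tsupport g ht) ?_
      rw [dist_comm, Real.dist_eq]
      exact (hθε.abs_sub_le t).trans hε1.le
    · exact (subset_tsupport g).trans (Metric.self_subset_cthickening _)
  · rw [eLpNorm_sub_comm]
    exact (eLpNorm_mono_measure _ Measure.restrict_le_self).trans hfg

/-- The heights of the soft layers: the union of the intervals `ε (k, k + lam)`, `k ∈ ℤ`. -/
def softHeights (lam ε : ℝ) : Set ℝ := {t | ∃ k : ℤ, t / ε - k ∈ Ioo 0 lam}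

theorem measurableSet_softHeights (lam ε : ℝ) : MeasurableSet (softHeights lam ε) := by
  have : softHeights lam ε = ⋃ k : ℤ, (fun t : ℝ => t / ε - k) ⁻¹' Ioo 0 lam := by
    ext t; simp [softHeights]
  rw [this]
  exact MeasurableSet.iUnion fun k =>
    (Measurable.sub_const (measurable_id.div_const ε) _) measurableSet_Ioo

/-- The primitive of `lam⁻¹ 1_soft`; it maps the soft part of each period affinely onto the whole
period and collapses the stiff part to a point. -/
noncomputable def layerMap (lam ε t : ℝ) : ℝ :=
  ∫ r in (0 : ℝ)..t, (softHeights lam ε).indicator (fun _ => lam⁻¹) r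

theorem isLayerMap_layerMap {lam ε : ℝ} (h0 : 0 < lam) (h1 : lam < 1) (hε : 0 < ε) :
    IsLayerMap lam⁻¹ ε (softHeights lam ε) (layerMap lam ε) := by
  set χ : ℝ → ℝ := (softHeights lam ε).indicator (fun _ => lam⁻¹) with hχ
  have hint : ∀ s t, IntervalIntegrable χ volume s t := by
    intro s t
    have h : IntervalIntegrable (fun _ : ℝ => lam⁻¹) volume s t := intervalIntegrable_const
    exact ⟨h.1.indicator (measurableSet_softHeights _ _),
      h.2.indicator (measurableSet_softHeights _ _)⟩
  have hsub : ∀ s t, layerMap lam ε t - layerMap lam ε s = ∫ r in s..t, χ r := fun s t =>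
    intervalIntegral.integral_interval_sub_left (hint 0 t) (hint 0 s)
  have hmono : Monotone (layerMap lam ε) := by
    intro s t hst
    rw [← sub_nonneg, hsub]
    exact intervalIntegral.integral_nonneg hst fun r _ =>
      indicator_nonneg (fun _ _ => (inv_pos.2 h0).le) r
  have hper : Function.Periodic χ ε := by
    intro t
    have : t + ε ∈ softHeights lam ε ↔ t ∈ softHeights lam ε := by
      have e : (t + ε) / ε = t / ε + 1 := by field_simp
      constructor
      · rintro ⟨k, hk⟩
        refine ⟨k - 1, ?_⟩
        rw [e] at hk
        push_cast
        convert hk using 1; ring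
      · rintro ⟨k, hk⟩
        refine ⟨k + 1, ?_⟩
        rw [e]
        push_cast
        convert hk using 1; ring
    by_cases ht : t ∈ softHeights lam ε
    · rw [hχ, indicator_of_mem ht, indicator_of_mem (this.2 ht)]
    · rw [hχ, indicator_of_notMem ht, indicator_of_notMem (mt this.1 ht)]
  have hone : ∫ r in (0 : ℝ)..(0 + ε), χ r = ε := by
    have hset : (softHeights lam ε ∩ Ioc 0 ε : Set ℝ) =ᵐ[volume] (Ioc 0 (lam * ε) : Set ℝ) := by
      have hn1 : ∀ᵐ t : ℝ, t ≠ ε := Measure.ae_ne volume _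
      have hn2 : ∀ᵐ t : ℝ, t ≠ lam * ε := Measure.ae_ne volume _
      filter_upwards [hn1, hn2] with t ht1 ht2
      refine propext ⟨?_, ?_⟩
      · rintro ⟨⟨k, hk⟩, ht⟩
        have a1 : t / ε < 1 := (div_lt_one hε).2 (lt_of_le_of_ne ht.2 ht1)
        have a2 : 0 < t / ε := div_pos ht.1 hε
        have hk0 : k = 0 := by
          have b1 : (k : ℝ) < 1 := by linarith [hk.1]
          have b2 : (-1 : ℝ) < k := by linarith [hk.2]
          have b1' : k < 1 := by exact_mod_cast b1
          have b2' : -1 < k := by exact_mod_cast b2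
          lia
        subst hk0
        refine ⟨ht.1, ?_⟩
        have := hk.2
        rw [Int.cast_zero, sub_zero, div_lt_iff₀ hε] at this
        exact this.le
      · intro ht
        refine ⟨⟨0, ?_⟩, ht.1, ht.2.trans ?_⟩
        · rw [Int.cast_zero, sub_zero]
          exact ⟨div_pos ht.1 hε, (div_lt_iff₀ hε).2 (lt_of_le_of_ne ht.2 ht2)⟩
        · nlinarith
    rw [zero_add, intervalIntegral.integral_of_le hε.le, hχ,
      integral_indicator (measurableSet_softHeights _ _),
      Measure.restrict_restrict (measurableSet_softHeights _ _), Measure.restrict_congr_set hset,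
      integral_const, measureReal_restrict_apply_univ, Real.volume_real_Ioc_of_le (by positivity),
      smul_eq_mul, sub_zero]
    field_simp
  have hk : ∀ k : ℤ, layerMap lam ε (k * ε) = k * ε := by
    intro k
    have := hper.intervalIntegral_add_zsmul_eq k 0 hint
    rw [hone, zero_add, zsmul_eq_mul] at this
    exact this
  refine ⟨inv_pos.2 h0, measurableSet_softHeights _ _, hsub, fun t => ?_⟩
  have l1 : (⌊t / ε⌋ : ℝ) * ε ≤ t := by
    rw [← le_div_iff₀ hε]; exact Int.floor_le _
  have l2 : t ≤ ((⌊t / ε⌋ + 1 : ℤ) : ℝ) * ε := by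
    rw [← div_le_iff₀ hε]; push_cast; exact (Int.lt_floor_add_one _).le
  have u1 := hmono l1
  have u2 := hmono l2
  rw [hk] at u1 u2
  push_cast at l2 u2
  rw [abs_le]
  constructor <;> linarith

/-! ### Cross sections of flat Lipschitz domains -/

/-- The last coordinate `x_n` of `x`. -/
def height {m : ℕ} (x : Space m) : ℝ := x (Fin.last m)

theorem continuous_height {m : ℕ} : Continuous (height : Space m → ℝ) :=
  PiLp.continuous_apply 2 _ (Fin.last m)

theorem measurable_height {m : ℕ} : Measurable (height : Space m → ℝ) :=
  continuous_height.measurable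

/-- The cylinder over a height set `E` whose base is the cube of half-width `r` centred at the
horizontal part of `c`. -/
def cubeCylinder {m : ℕ} (c : Space m) (r : ℝ) (E : Set ℝ) : Set (Space m) :=
  {x | (∀ i : Fin m, |x i.castSucc - c i.castSucc| < r) ∧ height x ∈ E}

theorem volume_cubeCylinder {m : ℕ} (c : Space m) (r : ℝ) (E : Set ℝ) :
    volume (cubeCylinder c r E) = ENNReal.ofReal (2 * r) ^ m * volume E := by
  have hpre : cubeCylinder c r E = (MeasurableEquiv.toLp 2 (Fin (m + 1) → ℝ)).symm ⁻¹'
      (Set.pi univ (Fin.lastCases E fun i : Fin m =>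
        Ioo (c i.castSucc - r) (c i.castSucc + r))) := by
    ext x
    simp only [cubeCylinder, mem_ofPred_eq, mem_preimage, Set.mem_pi, mem_univ, true_imp_iff]
    rw [Fin.forall_fin_succ']
    simp only [Fin.lastCases_castSucc, Fin.lastCases_last, mem_Ioo, abs_sub_lt_iff]
    refine and_congr (forall_congr' fun i => ?_) Iff.rfl
    change _ ↔ c i.castSucc - r < x i.castSucc ∧ x i.castSucc < c i.castSucc + r
    constructor <;> rintro ⟨h1, h2⟩ <;> constructor <;> linarith
  rw [hpre, (EuclideanSpace.volume_preserving_symm_measurableEquiv_toLp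
    (Fin (m + 1))).measure_preimage_equiv, volume_pi_pi, Fin.prod_univ_castSucc]
  simp only [Fin.lastCases_castSucc, Fin.lastCases_last, Real.volume_Ioo]
  congr 1
  rw [Finset.prod_eq_pow_card (b := ENNReal.ofReal (2 * r)) (fun i _ => by congr 1; ring),
    Finset.card_univ, Fintype.card_fin]

theorem exists_cubeCylinder_subset {m : ℕ} {x : Space m} {U : Set (Space m)} (hU : U ∈ 𝓝 x) :
    ∃ r > 0, cubeCylinder x r (Ioo (height x - r) (height x + r)) ⊆ U := by
  have hc : Continuous (WithLp.toLp 2 : (Fin (m + 1) → ℝ) → Space m) := PiLp.continuous_toLp 2 _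
  have h := hc.continuousAt (x := x.ofLp) hU
  obtain ⟨r, hr, hsub⟩ := Metric.mem_nhds_iff.1 h
  refine ⟨r, hr, fun y hy => ?_⟩
  have : y.ofLp ∈ Metric.ball x.ofLp r := by
    rw [Metric.mem_ball, dist_pi_lt_iff hr, Fin.forall_fin_succ']
    refine ⟨fun i => hy.1 i, ?_⟩
    have h2 := hy.2
    rw [Real.dist_eq, abs_sub_lt_iff]
    have e1 : height y = y (Fin.last m) := rfl
    have e2 : height x = x (Fin.last m) := rfl
    rw [e1, e2] at h2
    constructor <;> linarith [h2.1, h2.2]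
  exact hsub this

/-- A Lipschitz domain lying in the half-space `a < ℓ` and whose closure contains a relatively open
piece of the hyperplane `ℓ = a` fills the half-space near the points of that piece. Points above the
hyperplane are reached from it along the vertical direction of the local graph. -/
theorem exists_nhds_halfspace_subset {m : ℕ} {Ω : Set (Space m)} (hΩ : IsBoundedLipschitzDomain Ω)
    (ℓ : Space m →L[ℝ] ℝ) {a : ℝ} (ha : ∀ x ∈ Ω, a < ℓ x) {V : Set (Space m)} (hV : IsOpen V)
    {x₀ : Space m} (hx₀ : x₀ ∈ V) (hℓ : ℓ x₀ = a) (hVΩ : ∀ x ∈ V, ℓ x = a → x ∈ closure Ω) :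
    ∃ U ∈ 𝓝 x₀, ∀ x ∈ U, a < ℓ x → x ∈ Ω := by
  have hfr : x₀ ∈ frontier Ω := by
    rw [hΩ.isOpen.frontier_eq]
    exact ⟨hVΩ x₀ hx₀ hℓ, fun h => (ha x₀ h).ne' hℓ⟩
  obtain ⟨A, γ, K, r, hγ, hr, hgraph⟩ := hΩ.boundary x₀ hfr
  have hhor : Continuous (fun x : Space m => horizontal (A x)) := by
    refine (PiLp.continuous_toLp 2 _).comp (continuous_pi fun i => ?_)
    exact (PiLp.continuous_apply 2 _ _).comp A.continuous
  have hlast : Continuous (fun x : Space m => A x (Fin.last m)) :=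
    (PiLp.continuous_apply 2 _ _).comp A.continuous
  have hcl : ∀ y ∈ closure Ω, y ∈ Metric.ball x₀ r → γ (horizontal (A y)) ≤ A y (Fin.last m) := by
    intro y hy hyb
    have hC : IsClosed {y : Space m | γ (horizontal (A y)) ≤ A y (Fin.last m)} :=
      isClosed_le (hγ.continuous.comp hhor) hlast
    have h1 : y ∈ closure (Metric.ball x₀ r ∩ Ω) :=
      Metric.isOpen_ball.inter_closure ⟨hyb, hy⟩
    exact closure_minimal (fun z hz => ((hgraph z hz.1).1 hz.2).le) hC h1
  set v : Space m := A.symm (EuclideanSpace.single (Fin.last m) 1) with hv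
  have hAv : ∀ (x : Space m) (s : ℝ), A (x + s • v) = A x + s • EuclideanSpace.single (Fin.last m) 1 := by
    intro x s
    rw [map_add, map_smul, hv, LinearIsometryEquiv.apply_symm_apply]
  have hAvh : ∀ (x : Space m) (s : ℝ), horizontal (A (x + s • v)) = horizontal (A x) := by
    intro x s
    rw [hAv]
    ext i
    simp [horizontal]
  have hAvl : ∀ (x : Space m) (s : ℝ), A (x + s • v) (Fin.last m) = A x (Fin.last m) + s := by
    intro x s
    rw [hAv]
    simp
  have hℓv : 0 < ℓ v := by
    have hcont : Tendsto (fun s : ℝ => x₀ + s • v) (𝓝[>] 0) (𝓝 x₀) := by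
      have : Continuous (fun s : ℝ => x₀ + s • v) := by fun_prop
      have h := this.tendsto 0
      rw [zero_smul, add_zero] at h
      exact h.mono_left nhdsWithin_le_nhds
    have hball : ∀ᶠ s : ℝ in 𝓝[>] 0, x₀ + s • v ∈ Metric.ball x₀ r :=
      hcont.eventually (Metric.ball_mem_nhds x₀ hr)
    obtain ⟨s, hs, hs0⟩ := (hball.and self_mem_nhdsWithin).exists
    have hs0' : 0 < s := hs0
    have hmem : x₀ + s • v ∈ Ω := by
      rw [hgraph _ hs, hAvh, hAvl]
      have := hcl x₀ (hVΩ x₀ hx₀ hℓ) (Metric.mem_ball_self hr)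
      linarith
    have h := ha _ hmem
    rw [map_add, map_smul, hℓ, smul_eq_mul] at h
    exact pos_of_mul_pos_right (by linarith) hs0'.le
  set σ : Space m → ℝ := fun x => (ℓ x - a) / ℓ v with hσ
  have hcσ : Continuous (fun x => x + (-σ x) • v) := by
    have : Continuous σ := by rw [hσ]; fun_prop
    fun_prop
  have hσ0 : x₀ + (-σ x₀) • v = x₀ := by simp [hσ, hℓ]
  have hW : V ∩ Metric.ball x₀ r ∈ 𝓝 (x₀ + (-σ x₀) • v) := by
    rw [hσ0]
    exact Filter.inter_mem (hV.mem_nhds hx₀) (Metric.ball_mem_nhds x₀ hr)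
  refine ⟨_, Filter.inter_mem (Metric.ball_mem_nhds x₀ hr) (hcσ.continuousAt hW), ?_⟩
  rintro x ⟨hx1, hx2⟩ hax
  have hx2' : x + (-σ x) • v ∈ V ∩ Metric.ball x₀ r := hx2
  have hy : ℓ (x + (-σ x) • v) = a := by
    rw [map_add, map_smul, smul_eq_mul, hσ]
    field_simp
    ring
  have h := hcl _ (hVΩ _ hx2'.1 hy) hx2'.2
  rw [hAvh, hAvl] at h
  have hpos : 0 < σ x := div_pos (by linarith) hℓv
  rw [hgraph x hx1]
  linarith

/-- The interval `(a, b)` is the range of heights of `Ω`, and `Ω` contains a cylinder of fixed base near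
every height of `[a, b]`, the endpoints included. -/
structure IsHeightInterval {m : ℕ} (Ω : Set (Space m)) (a b : ℝ) : Prop where
  lt : a < b
  image_eq : height '' Ω = Ioo a b
  exists_cylinder : ∀ t ∈ Icc a b, ∃ (c : Space m) (r : ℝ), 0 < r ∧
    cubeCylinder c r (Ioo (t - r) (t + r) ∩ Ioo a b) ⊆ Ω

theorem exists_isHeightInterval {m : ℕ} {Ω : Set (Space m)} (hΩ : IsBoundedLipschitzDomain Ω)
    (hflat : IsFlat Ω) : ∃ a b, IsHeightInterval Ω a b := by
  set ℓ : Space m →L[ℝ] ℝ := EuclideanSpace.proj (Fin.last m) with hℓ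
  have hℓh : ∀ x, ℓ x = height x := fun x => rfl
  have hopen : IsOpen (height '' Ω) := by
    refine ℓ.isOpenMap (fun t => ⟨EuclideanSpace.single (Fin.last m) t, ?_⟩) _ hΩ.isOpen
    simp [hℓ]
  have hconn : IsConnected (height '' Ω) := hΩ.isConnected.image _ continuous_height.continuousOn
  have hKc : IsCompact (closure Ω) := hΩ.isBounded.isCompact_closure
  have hbdd : Bornology.IsBounded (height '' Ω) :=
    ((hKc.image continuous_height).isBounded).subset (image_mono subset_closure)
  set a := sInf (height '' Ω)
  set b := sSup (height '' Ω)
  have himg : height '' Ω = Ioo a b := by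
    refine Subset.antisymm ?_ (hconn.Ioo_csInf_csSup_subset hbdd.bddBelow hbdd.bddAbove)
    rw [← interior_Icc]
    exact hopen.subset_interior_iff.2 (subset_Icc_csInf_csSup hbdd.bddBelow hbdd.bddAbove)
  have hab : a < b := by
    have := hconn.nonempty
    rw [himg] at this
    exact nonempty_Ioo.1 this
  have hmem : ∀ x ∈ Ω, height x ∈ Ioo a b := fun x hx => himg ▸ mem_image_of_mem _ hx
  have hclosed : Icc a b ⊆ height '' closure Ω := by
    rw [← closure_Ioo hab.ne, ← himg]
    exact closure_minimal (image_mono subset_closure) (hKc.image continuous_height).isClosed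
  refine ⟨a, b, hab, himg, fun t ht => ?_⟩
  obtain ⟨x₀, hx₀, U, hU, hUΩ⟩ : ∃ x₀ : Space m, height x₀ = t ∧ ∃ U ∈ 𝓝 x₀,
      ∀ x ∈ U, height x ∈ Ioo a b → x ∈ Ω := by
    have hpiece : ∃ V : Set (Space m), IsOpen V ∧ (V ∩ hyperplane m t).Nonempty ∧
        V ∩ hyperplane m t ⊆ closure Ω := by
      refine (hflat t).resolve_left (Set.Nonempty.ne_empty ?_)
      obtain ⟨x, hx, hxt⟩ := hclosed ht
      exact ⟨x, hx, hxt⟩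
    obtain ⟨V, hV, ⟨x₀, hx₀V, hx₀t⟩, hVΩ⟩ := hpiece
    have hx₀t' : height x₀ = t := hx₀t
    rcases eq_or_lt_of_le ht.1 with rfl | hat
    · obtain ⟨U, hU, h⟩ := exists_nhds_halfspace_subset hΩ ℓ (a := a) (fun x hx => (hmem x hx).1) hV
        hx₀V hx₀t fun x hx hxa => hVΩ ⟨hx, hxa⟩
      exact ⟨x₀, hx₀t, U, hU, fun x hx hxa => h x hx hxa.1⟩
    rcases eq_or_lt_of_le ht.2 with rfl | htb
    · obtain ⟨U, hU, h⟩ := exists_nhds_halfspace_subset hΩ (-ℓ) (a := -b)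
        (fun x hx => neg_lt_neg (hmem x hx).2) hV hx₀V (by simp [hℓh, hx₀t'])
        fun x hx hxa => hVΩ ⟨hx, neg_injective hxa⟩
      exact ⟨x₀, hx₀t, U, hU, fun x hx hxa => h x hx (neg_lt_neg hxa.2)⟩
    have : t ∈ height '' Ω := himg ▸ ⟨hat, htb⟩
    obtain ⟨x, hx, hxt⟩ := this
    exact ⟨x, hxt, Ω, hΩ.isOpen.mem_nhds hx, fun y hy _ => hy⟩
  obtain ⟨r, hr, hsub⟩ := exists_cubeCylinder_subset hU
  rw [hx₀] at hsub
  refine ⟨x₀, r, hr, fun y hy => hUΩ y (hsub ⟨hy.1, hy.2.1⟩) hy.2.2⟩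

/-- Bounded sets have cross sections of bounded area. -/
theorem exists_map_height_le {m : ℕ} {Ω : Set (Space m)} (hΩ : Bornology.IsBounded Ω) :
    ∃ C : ℝ≥0∞, C ≠ ⊤ ∧ (volume.restrict Ω).map height ≤ C • volume := by
  obtain ⟨ρ, hρ⟩ := hΩ.subset_ball (0 : Space m)
  refine ⟨ENNReal.ofReal (2 * ρ) ^ m, ENNReal.pow_ne_top ENNReal.ofReal_ne_top, ?_⟩
  refine Measure.le_iff.2 fun E hE => ?_
  rw [Measure.map_apply measurable_height hE,
    Measure.restrict_apply (measurable_height hE), Measure.smul_apply, smul_eq_mul,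
    ← volume_cubeCylinder (0 : Space m)]
  refine measure_mono fun x hx => ⟨fun i => ?_, hx.1⟩
  have h1 := hρ hx.2
  rw [mem_ball_zero_iff] at h1
  have h2 := PiLp.norm_apply_le x i.castSucc
  simpa using h2.trans_lt h1

namespace IsHeightInterval

variable {m : ℕ} {Ω : Set (Space m)} {a b : ℝ}

theorem mem (h : IsHeightInterval Ω a b) {x : Space m} (hx : x ∈ Ω) : height x ∈ Ioo a b :=
  h.image_eq ▸ mem_image_of_mem _ hx

/-- The areas of the cross sections are bounded below on the whole range of heights. -/
theorem exists_restrict_le (h : IsHeightInterval Ω a b) :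
    ∃ C : ℝ≥0∞, C ≠ ⊤ ∧ volume.restrict (Ioo a b) ≤ C • (volume.restrict Ω).map height := by
  have key : ∃ C : ℝ≥0∞, C ≠ ⊤ ∧
      volume.restrict (Icc a b ∩ Ioo a b) ≤ C • (volume.restrict Ω).map height := by
    refine isCompact_Icc.induction_on (p := fun s : Set ℝ => ∃ C : ℝ≥0∞, C ≠ ⊤ ∧
      volume.restrict (s ∩ Ioo a b) ≤ C • (volume.restrict Ω).map height) ?_ ?_ ?_ ?_
    · exact ⟨0, ENNReal.zero_ne_top, by simp⟩
    · rintro s t hst ⟨C, hC, ht⟩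
      exact ⟨C, hC, (Measure.restrict_mono (inter_subset_inter_left _ hst) le_rfl).trans ht⟩
    · rintro s t ⟨C, hC, hs⟩ ⟨D, hD, ht⟩
      refine ⟨C + D, ENNReal.add_ne_top.2 ⟨hC, hD⟩, ?_⟩
      rw [union_inter_distrib_right, add_smul]
      exact (Measure.restrict_union_le _ _).trans (add_le_add hs ht)
    · intro t ht
      obtain ⟨c, r, hr, hsub⟩ := h.exists_cylinder t ht
      have hr2 : ENNReal.ofReal (2 * r) ^ m ≠ 0 :=
        pow_ne_zero _ (ENNReal.ofReal_pos.2 (by positivity)).ne'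
      have hr3 : ENNReal.ofReal (2 * r) ^ m ≠ ⊤ := ENNReal.pow_ne_top ENNReal.ofReal_ne_top
      refine ⟨Ioo (t - r) (t + r), mem_nhdsWithin_of_mem_nhds
        (Ioo_mem_nhds (by linarith) (by linarith)), (ENNReal.ofReal (2 * r) ^ m)⁻¹,
        ENNReal.inv_ne_top.2 hr2, ?_⟩
      refine Measure.le_iff.2 fun E hE => ?_
      rw [Measure.restrict_apply hE, Measure.smul_apply, smul_eq_mul,
        Measure.map_apply measurable_height hE, Measure.restrict_apply (measurable_height hE)]
      have h1 := volume_cubeCylinder c r (E ∩ (Ioo (t - r) (t + r) ∩ Ioo a b))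
      have h2 : volume (E ∩ (Ioo (t - r) (t + r) ∩ Ioo a b)) = (ENNReal.ofReal (2 * r) ^ m)⁻¹ *
          volume (cubeCylinder c r (E ∩ (Ioo (t - r) (t + r) ∩ Ioo a b))) := by
        rw [h1, ← mul_assoc, ENNReal.inv_mul_cancel hr2 hr3, one_mul]
      rw [h2]
      gcongr
      exact fun x hx => ⟨hx.2.1, hsub ⟨hx.1, hx.2.2⟩⟩
  rwa [inter_eq_right.2 Ioo_subset_Icc_self] at key

end IsHeightInterval

/-! ### Weak derivatives of functions of the height -/

theorem memLp_comp_height {m : ℕ} {Ω : Set (Space m)} (hΩ : Bornology.IsBounded Ω) {p : ℝ≥0∞}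
    {f : ℝ → ℝ} (hf : MemLp f p volume) :
    MemLp (fun x => f (height x)) p (volume.restrict Ω) := by
  obtain ⟨C, hC, hle⟩ := exists_map_height_le hΩ
  exact (hf.of_measure_le_smul hC hle).comp_of_map measurable_height.aemeasurable

theorem locallyIntegrable_comp_height {m : ℕ} {f : ℝ → ℝ} (hf : Integrable f volume) :
    LocallyIntegrable (fun x : Space m => f (height x)) volume :=
  locallyIntegrable_iff.2 fun _ hK =>
    memLp_one_iff_integrable.1 (memLp_comp_height hK.isBounded (memLp_one_iff_integrable.2 hf))

theorem fderiv_height_apply {m : ℕ} {F : ℝ → ℝ} {f' : ℝ} {x : Space m}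
    (hF : HasDerivAt F f' (height x)) (j : Fin (m + 1)) :
    fderiv ℝ (fun x : Space m => F (height x)) x (EuclideanSpace.single j 1)
      = if j = Fin.last m then f' else 0 := by
  have h1 : HasFDerivAt (fun x : Space m => height x)
      (EuclideanSpace.proj (Fin.last m) : Space m →L[ℝ] ℝ) x :=
    (EuclideanSpace.proj (Fin.last m) : Space m →L[ℝ] ℝ).hasFDerivAt
  have h2 := (hF.comp_hasFDerivAt x h1).fderiv
  rw [Function.comp_def] at h2
  rw [h2]
  simp [eq_comm]

theorem continuous_fderiv_apply_const {m : ℕ} {φ : Space m → ℝ} (hφ : ContDiff ℝ ∞ φ)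
    (v : Space m) : Continuous (fun x => fderiv ℝ φ x v) :=
  (hφ.continuous_fderiv (by simp)).clm_apply continuous_const

theorem continuous_of_sub_eq_integral {f F : ℝ → ℝ} (hf : Integrable f volume)
    (hF : ∀ s t, F t - F s = ∫ r in s..t, f r) : Continuous F := by
  have h : F = fun t => F 0 + ∫ r in (0 : ℝ)..t, f r := by
    ext t; rw [← hF]; ring
  rw [h]
  exact continuous_const.add
    (intervalIntegral.continuous_primitive (fun _ _ => hf.intervalIntegrable) 0)

/-- Integration by parts for a function of the height that is a primitive of a continuous function. -/
theorem integral_comp_height_mul_fderiv_of_continuous {m : ℕ} {f F : ℝ → ℝ} (hf : Continuous f)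
    (hF : ∀ s t, F t - F s = ∫ r in s..t, f r) {ψ : Space m → ℝ} (hψ : ContDiff ℝ ∞ ψ)
    (hψc : HasCompactSupport ψ) (j : Fin (m + 1)) :
    ∫ x, F (height x) * fderiv ℝ ψ x (EuclideanSpace.single j 1)
      = -∫ x, (if j = Fin.last m then f (height x) else 0) * ψ x := by
  have hFd : ∀ t, HasDerivAt F (f t) t := by
    intro t
    have h : F = fun t => F 0 + ∫ r in (0 : ℝ)..t, f r := by
      ext t; rw [← hF]; ring
    rw [h]
    exact (intervalIntegral.integral_hasDerivAt_right (hf.intervalIntegrable _ _)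
      (hf.stronglyMeasurableAtFilter _ _) hf.continuousAt).const_add _
  have hFc : Continuous F := continuous_iff_continuousAt.2 fun t => (hFd t).continuousAt
  have hd : ∀ x : Space m, fderiv ℝ (fun x : Space m => F (height x)) x (EuclideanSpace.single j 1)
      = if j = Fin.last m then f (height x) else 0 := fun x => fderiv_height_apply (hFd _) j
  have hifc : Continuous (fun x : Space m => if j = Fin.last m then f (height x) else 0) := by
    split_ifs
    · exact hf.comp continuous_height
    · exact continuous_const
  have hFh : Differentiable ℝ (fun x : Space m => F (height x)) := by
    intro x
    have h1 : HasFDerivAt (fun x : Space m => height x)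
        (EuclideanSpace.proj (Fin.last m) : Space m →L[ℝ] ℝ) x :=
      (EuclideanSpace.proj (Fin.last m) : Space m →L[ℝ] ℝ).hasFDerivAt
    exact ((hFd (height x)).comp_hasFDerivAt x h1).differentiableAt
  have hc := HasCompactSupport.fderiv_apply ℝ hψc (EuclideanSpace.single j 1)
  have hcc := continuous_fderiv_apply_const hψ (EuclideanSpace.single j 1)
  have key := integral_mul_fderiv_eq_neg_fderiv_mul_of_integrable
    (μ := (volume : Measure (Space m))) (f := fun x => F (height x)) (g := ψ)
    (v := EuclideanSpace.single j 1) ?_ ?_ ?_ (fun x _ => hFh x)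
    (fun x _ => hψ.differentiable (by simp) x)
  · rw [key]
    simp only [hd]
  · simp only [hd]
    exact (hifc.mul hψ.continuous).integrable_of_hasCompactSupport hψc.mul_left
  · exact ((hFc.comp continuous_height).mul hcc).integrable_of_hasCompactSupport hc.mul_left
  · exact ((hFc.comp continuous_height).mul hψ.continuous).integrable_of_hasCompactSupport
      hψc.mul_left

/-- Integration by parts for a function of the height that is a primitive of an integrable function,
by approximating the latter in `L¹` by continuous functions. -/
theorem integral_comp_height_mul_fderiv {m : ℕ} {f F : ℝ → ℝ} (hf : Integrable f volume)
    (hF : ∀ s t, F t - F s = ∫ r in s..t, f r) {ψ : Space m → ℝ} (hψ : ContDiff ℝ ∞ ψ)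
    (hψc : HasCompactSupport ψ) (j : Fin (m + 1)) :
    ∫ x, F (height x) * fderiv ℝ ψ x (EuclideanSpace.single j 1)
      = -∫ x, (if j = Fin.last m then f (height x) else 0) * ψ x := by
  set e : Space m := EuclideanSpace.single j 1 with he
  have hc := HasCompactSupport.fderiv_apply ℝ hψc e
  have hcc := continuous_fderiv_apply_const hψ e
  obtain ⟨B, hB⟩ := hψ.continuous.bounded_above_of_compact_support hψc
  have hB0 : 0 ≤ B := (norm_nonneg _).trans (hB 0)
  obtain ⟨C, hC, hle⟩ := exists_map_height_le hψc.isCompact.isBounded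
  set M := ∫ x, ‖fderiv ℝ ψ x e‖ with hM
  have hFc := continuous_of_sub_eq_integral hf hF
  have hint : ∀ {h : ℝ → ℝ}, Integrable h volume →
      Integrable (fun x : Space m => (if j = Fin.last m then h (height x) else 0) * ψ x) := by
    intro h hh
    by_cases hj : j = Fin.last m
    · simp only [hj, if_true]
      have := (locallyIntegrable_comp_height (m := m) hh).integrable_smul_left_of_hasCompactSupport
        hψ.continuous hψc
      simpa [mul_comm] using this
    · simp [hj]
  rw [← sub_eq_zero, sub_neg_eq_add, ← norm_eq_zero]
  refine le_antisymm (le_of_forall_pos_le_add fun η hη => ?_) (norm_nonneg _)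
  set δ := η / (M + B * C.toReal + 1) with hδdef
  have hM0 : 0 ≤ M := integral_nonneg fun _ => norm_nonneg _
  have hden : 0 < M + B * C.toReal + 1 := by positivity
  have hδ : 0 < δ := by positivity
  obtain ⟨g, hgc, hfg, hgcont, hg⟩ := hf.exists_hasCompactSupport_integral_sub_le hδ
  set G : ℝ → ℝ := fun t => F 0 + ∫ r in (0 : ℝ)..t, g r with hG
  have hGs : ∀ s t, G t - G s = ∫ r in s..t, g r := by
    intro s t
    have := intervalIntegral.integral_interval_sub_left (hg.intervalIntegrable (a := 0) (b := t))
      (hg.intervalIntegrable (a := 0) (b := s))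
    rw [← this, hG]; ring
  have hGc := continuous_of_sub_eq_integral hg hGs
  have hFG : ∀ t, ‖F t - G t‖ ≤ δ := by
    intro t
    have h1 : F t - G t = ∫ r in (0 : ℝ)..t, (f r - g r) := by
      rw [intervalIntegral.integral_sub hf.intervalIntegrable hg.intervalIntegrable, ← hF, hG]
      ring
    rw [h1]
    refine (intervalIntegral.norm_integral_le_integral_norm_uIoc).trans (le_trans ?_ hfg)
    exact setIntegral_le_integral (hf.sub hg).norm (Eventually.of_forall fun _ => norm_nonneg _)
  have key := integral_comp_height_mul_fderiv_of_continuous hgcont hGs hψ hψc j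
  have i1 : Integrable (fun x => F (height x) * fderiv ℝ ψ x e) :=
    ((hFc.comp continuous_height).mul hcc).integrable_of_hasCompactSupport hc.mul_left
  have i2 : Integrable (fun x => G (height x) * fderiv ℝ ψ x e) :=
    ((hGc.comp continuous_height).mul hcc).integrable_of_hasCompactSupport hc.mul_left
  have b1 : ‖∫ x, (F (height x) * fderiv ℝ ψ x e - G (height x) * fderiv ℝ ψ x e)‖ ≤ δ * M := by
    rw [hM, ← integral_const_mul]
    refine norm_integral_le_of_norm_le ((hcc.integrable_of_hasCompactSupport hc).norm.const_mul δ)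
      (Eventually.of_forall fun x => ?_)
    rw [← sub_mul, norm_mul]
    gcongr
    exact hFG _
  have b2 : ‖∫ x, ((if j = Fin.last m then f (height x) else 0) * ψ x
      - (if j = Fin.last m then g (height x) else 0) * ψ x)‖ ≤ δ * (B * C.toReal) := by
    have hsupp : Function.support (fun x : Space m => (if j = Fin.last m then f (height x) else 0) * ψ x
        - (if j = Fin.last m then g (height x) else 0) * ψ x) ⊆ tsupport ψ := by
      intro x hx
      refine subset_tsupport ψ fun h => hx ?_
      simp [h]
    rw [← setIntegral_eq_integral_of_forall_compl_eq_zero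
      (fun x hx => Function.notMem_support.1 fun h => hx (hsupp h))]
    have hI : Integrable (fun t => ‖f t - g t‖) (C • (volume : Measure ℝ)) :=
      (hf.sub hg).norm.smul_measure hC
    have hI' : Integrable (fun t => ‖f t - g t‖) ((volume.restrict (tsupport ψ)).map height) :=
      hI.mono_measure hle
    have hI'' : Integrable (fun x : Space m => ‖f (height x) - g (height x)‖)
        (volume.restrict (tsupport ψ)) := hI'.comp_measurable measurable_height
    have h3 : ∫ x in tsupport ψ, ‖f (height x) - g (height x)‖ ≤ C.toReal * δ := by
      have h4 := integral_map (μ := volume.restrict (tsupport ψ))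
        measurable_height.aemeasurable hI'.aestronglyMeasurable
      rw [← h4]
      refine (integral_mono_measure hle (Eventually.of_forall fun _ => norm_nonneg _) hI).trans ?_
      rw [integral_smul_measure, smul_eq_mul]
      gcongr
    calc _ ≤ ∫ x in tsupport ψ, B * ‖f (height x) - g (height x)‖ := by
          refine norm_integral_le_of_norm_le (hI''.const_mul B) (Eventually.of_forall fun x => ?_)
          rw [← sub_mul, norm_mul, mul_comm]
          refine mul_le_mul (hB x) ?_ (norm_nonneg _) hB0
          split_ifs
          · exact le_rfl
          · simp
      _ = B * ∫ x in tsupport ψ, ‖f (height x) - g (height x)‖ := integral_const_mul _ _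
      _ ≤ B * (C.toReal * δ) := by gcongr
      _ = _ := by ring
  rw [integral_sub i1 i2] at b1
  rw [integral_sub (hint hf) (hint hg)] at b2
  have e : (∫ x, F (height x) * fderiv ℝ ψ x e)
      + ∫ x, (if j = Fin.last m then f (height x) else 0) * ψ x
      = ((∫ x, F (height x) * fderiv ℝ ψ x e) - ∫ x, G (height x) * fderiv ℝ ψ x e)
        + ((∫ x, (if j = Fin.last m then f (height x) else 0) * ψ x)
        - ∫ x, (if j = Fin.last m then g (height x) else 0) * ψ x) := by
    rw [key]; ring
  rw [e, zero_add]
  refine (norm_add_le _ _).trans ((add_le_add b1 b2).trans ?_)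
  rw [← mul_add, hδdef, div_mul_eq_mul_div, div_le_iff₀ hden]
  exact mul_le_mul_of_nonneg_left (by linarith) hη.le

/-- Product rule: the weak derivatives of `F(x_n) h(x)` for a primitive `F` of an integrable function
`f` and a smooth function `h`. -/
theorem hasWeakPartial_comp_height_mul {m : ℕ} (Ω : Set (Space m)) {f F : ℝ → ℝ}
    (hf : Integrable f volume) (hF : ∀ s t, F t - F s = ∫ r in s..t, f r) {h : Space m → ℝ}
    (hh : ContDiff ℝ ∞ h) (j : Fin (m + 1)) :
    HasWeakPartial Ω j (fun x => F (height x) * h x) (fun x =>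
      (if j = Fin.last m then f (height x) else 0) * h x
        + F (height x) * fderiv ℝ h x (EuclideanSpace.single j 1)) := by
  set e : Space m := EuclideanSpace.single j 1 with he
  have hFc : Continuous fun x : Space m => F (height x) :=
    (continuous_of_sub_eq_integral hf hF).comp continuous_height
  have hhe := continuous_fderiv_apply_const hh e
  have hloc : LocallyIntegrable (fun x : Space m => if j = Fin.last m then f (height x) else 0) := by
    split_ifs
    · exact locallyIntegrable_comp_height hf
    · exact locallyIntegrable_zero
  have hloch : LocallyIntegrable
      (fun x : Space m => (if j = Fin.last m then f (height x) else 0) * h x) := by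
    refine locallyIntegrable_iff.2 fun K hK => ?_
    exact (hloc.integrableOn_isCompact hK).mul_continuousOn hh.continuous.continuousOn hK
  refine ⟨((hFc.mul hh.continuous).locallyIntegrable).locallyIntegrableOn Ω,
    (hloch.add (hFc.mul hhe).locallyIntegrable).locallyIntegrableOn Ω, fun φ hφ hφc hφΩ => ?_⟩
  have z1 : ∀ x, x ∉ Ω → φ x = 0 := fun x hx => image_eq_zero_of_notMem_tsupport fun h => hx (hφΩ h)
  have z2 : ∀ x, x ∉ Ω → fderiv ℝ φ x e = 0 := fun x hx =>
    Function.notMem_support.1 fun h => hx (hφΩ (tsupport_fderiv_apply_subset ℝ e (subset_tsupport _ h)))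
  rw [setIntegral_eq_integral_of_forall_compl_eq_zero (fun x hx => by rw [z2 x hx, mul_zero]),
    setIntegral_eq_integral_of_forall_compl_eq_zero (fun x hx => by rw [z1 x hx, mul_zero])]
  have key : ∫ x, F (height x) * fderiv ℝ (fun x => h x * φ x) x e
      = -∫ x, (if j = Fin.last m then f (height x) else 0) * (h x * φ x) :=
    integral_comp_height_mul_fderiv hf hF (hh.mul hφ) hφc.mul_left j
  have hd : ∀ x, fderiv ℝ (fun x => h x * φ x) x e = h x * fderiv ℝ φ x e + φ x * fderiv ℝ h x e := by
    intro x
    rw [fderiv_fun_mul (hh.differentiable (by simp) x) (hφ.differentiable (by simp) x)]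
    simp
  have hcc := continuous_fderiv_apply_const hφ e
  have hc := HasCompactSupport.fderiv_apply ℝ hφc e
  have i1 : Integrable (fun x => F (height x) * h x * fderiv ℝ φ x e) :=
    ((hFc.mul hh.continuous).mul hcc).integrable_of_hasCompactSupport hc.mul_left
  have i2 : Integrable (fun x => F (height x) * fderiv ℝ h x e * φ x) :=
    ((hFc.mul hhe).mul hφ.continuous).integrable_of_hasCompactSupport hφc.mul_left
  have i3 : Integrable (fun x => (if j = Fin.last m then f (height x) else 0) * h x * φ x) := by
    have := hloch.integrable_smul_left_of_hasCompactSupport hφ.continuous hφc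
    simpa [mul_comm] using this
  simp only [hd] at key
  have e1 : ∀ x, F (height x) * (h x * fderiv ℝ φ x e + φ x * fderiv ℝ h x e)
      = F (height x) * h x * fderiv ℝ φ x e + F (height x) * fderiv ℝ h x e * φ x := fun x => by ring
  have e2 : ∀ x, (if j = Fin.last m then f (height x) else 0) * (h x * φ x)
      = (if j = Fin.last m then f (height x) else 0) * h x * φ x := fun x => by ring
  simp only [e1, e2] at key
  rw [integral_add i1 i2] at key
  simp only [add_mul]
  rw [integral_add i3 i2]
  linarith

/-! ### Calculus of weak partial derivatives -/

theorem integrableOn_mul_of_tsupport_subset {m : ℕ} {Ω : Set (Space m)} {f φ : Space m → ℝ}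
    (hf : LocallyIntegrableOn f Ω volume) (hφ : Continuous φ) (hφc : HasCompactSupport φ)
    (hφΩ : tsupport φ ⊆ Ω) : IntegrableOn (fun x => f x * φ x) Ω volume := by
  have h1 : IntegrableOn (fun x => f x * φ x) (tsupport φ) volume :=
    (hf.integrableOn_compact_subset hφΩ hφc.isCompact).mul_continuousOn hφ.continuousOn
      hφc.isCompact
  have h2 : Integrable (fun x => f x * φ x) volume :=
    (integrableOn_iff_integrable_of_support_subset fun x hx =>
      subset_tsupport φ fun h => hx (by simp [h])).1 h1
  exact h2.integrableOn

theorem LocallyIntegrableOn.congr_ae_restrict {m : ℕ} {Ω : Set (Space m)} {f f' : Space m → ℝ}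
    (hf : LocallyIntegrableOn f Ω volume) (h : f =ᵐ[volume.restrict Ω] f') :
    LocallyIntegrableOn f' Ω volume := by
  intro x hx
  obtain ⟨s, hs, hi⟩ := hf x hx
  refine ⟨s ∩ Ω, Filter.inter_mem hs self_mem_nhdsWithin, ?_⟩
  exact (hi.mono_set inter_subset_left).congr
    (ae_restrict_of_ae_restrict_of_subset inter_subset_right h)

namespace HasWeakPartial

variable {m : ℕ} {Ω : Set (Space m)} {j : Fin (m + 1)} {f f' g g' : Space m → ℝ}

theorem congr_ae (h : HasWeakPartial Ω j f g) (hf : f =ᵐ[volume.restrict Ω] f')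
    (hg : g =ᵐ[volume.restrict Ω] g') : HasWeakPartial Ω j f' g' := by
  refine ⟨LocallyIntegrableOn.congr_ae_restrict h.1 hf,
    LocallyIntegrableOn.congr_ae_restrict h.2.1 hg, fun φ h1 h2 h3 => ?_⟩
  have e1 : ∫ x in Ω, f' x * fderiv ℝ φ x (EuclideanSpace.single j 1)
      = ∫ x in Ω, f x * fderiv ℝ φ x (EuclideanSpace.single j 1) :=
    integral_congr_ae (by filter_upwards [hf] with x hx; rw [hx])
  have e2 : ∫ x in Ω, g' x * φ x = ∫ x in Ω, g x * φ x :=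
    integral_congr_ae (by filter_upwards [hg] with x hx; rw [hx])
  rw [e1, e2]
  exact h.2.2 φ h1 h2 h3

theorem add (h : HasWeakPartial Ω j f g) (h' : HasWeakPartial Ω j f' g') :
    HasWeakPartial Ω j (fun x => f x + f' x) (fun x => g x + g' x) := by
  refine ⟨h.1.add h'.1, h.2.1.add h'.2.1, fun φ h1 h2 h3 => ?_⟩
  have c1 := continuous_fderiv_apply_const h1 (EuclideanSpace.single j 1)
  have c2 := HasCompactSupport.fderiv_apply ℝ h2 (EuclideanSpace.single j 1)
  have c3 := (tsupport_fderiv_apply_subset ℝ (EuclideanSpace.single j 1)).trans h3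
  simp only [add_mul]
  rw [integral_add (integrableOn_mul_of_tsupport_subset h.1 c1 c2 c3)
      (integrableOn_mul_of_tsupport_subset h'.1 c1 c2 c3),
    integral_add (integrableOn_mul_of_tsupport_subset h.2.1 h1.continuous h2 h3)
      (integrableOn_mul_of_tsupport_subset h'.2.1 h1.continuous h2 h3), h.2.2 φ h1 h2 h3,
    h'.2.2 φ h1 h2 h3]
  ring

theorem neg (h : HasWeakPartial Ω j f g) :
    HasWeakPartial Ω j (fun x => -f x) (fun x => -g x) := by
  refine ⟨h.1.neg, h.2.1.neg, fun φ h1 h2 h3 => ?_⟩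
  simp only [neg_mul, integral_neg]
  rw [h.2.2 φ h1 h2 h3]

theorem sub (h : HasWeakPartial Ω j f g) (h' : HasWeakPartial Ω j f' g') :
    HasWeakPartial Ω j (fun x => f x - f' x) (fun x => g x - g' x) := by
  simpa only [sub_eq_add_neg] using h.add h'.neg

theorem sum {ι : Type*} (s : Finset ι) {F G : ι → Space m → ℝ}
    (h : ∀ i ∈ s, HasWeakPartial Ω j (F i) (G i)) :
    HasWeakPartial Ω j (fun x => ∑ i ∈ s, F i x) (fun x => ∑ i ∈ s, G i x) := by
  classical
  induction s using Finset.induction_on with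
  | empty =>
    have h0 : LocallyIntegrableOn (fun _ : Space m => (0 : ℝ)) Ω volume :=
      locallyIntegrable_zero.locallyIntegrableOn Ω
    simp only [Finset.sum_empty]
    exact ⟨h0, h0, fun φ _ _ _ => by simp⟩
  | insert i s hi ih =>
    simp only [Finset.sum_insert hi]
    exact (h i (Finset.mem_insert_self i s)).add
      (ih fun k hk => h k (Finset.mem_insert_of_mem hk))

theorem ae_eq (hΩ : IsOpen Ω) (h : HasWeakPartial Ω j f g) (h' : HasWeakPartial Ω j f g') :
    g =ᵐ[volume.restrict Ω] g' := by
  have hs := h.sub h'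
  have key := hΩ.ae_eq_zero_of_integral_contDiff_smul_eq_zero hs.2.1 fun φ h1 h2 h3 => ?_
  · rw [Filter.EventuallyEq, ae_restrict_iff' hΩ.measurableSet]
    filter_upwards [key] with x hx hxΩ
    exact sub_eq_zero.1 (hx hxΩ)
  · have := hs.2.2 φ h1 h2 h3
    simp only [sub_self, zero_mul, integral_zero] at this
    have z1 : ∀ x, x ∉ Ω → φ x • (g x - g' x) = 0 := fun x hx => by
      rw [image_eq_zero_of_notMem_tsupport fun h => hx (h3 h), zero_smul]
    rw [← setIntegral_eq_integral_of_forall_compl_eq_zero z1]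
    simp only [smul_eq_mul, mul_comm (φ _)]
    linarith

/-- If `f` does not depend on `x_k`, then neither does `∂_j f`. -/
theorem partial_eq_zero {k : Fin (m + 1)} (h : HasWeakPartial Ω j f g)
    (hk : HasWeakPartial Ω k f fun _ => 0) : HasWeakPartial Ω k g fun _ => 0 := by
  refine ⟨h.2.1, hk.2.1, fun φ h1 h2 h3 => ?_⟩
  set ej : Space m := EuclideanSpace.single j 1
  set ek : Space m := EuclideanSpace.single k 1
  have hdiff : ∀ v : Space m, ContDiff ℝ ∞ fun x => fderiv ℝ φ x v := fun v =>
    (h1.fderiv_right (m := ∞) (by simp)).clm_apply contDiff_const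
  have hd2 : ∀ (v w x : Space m), fderiv ℝ (fun x => fderiv ℝ φ x v) x w
      = fderiv ℝ (fderiv ℝ φ) x w v := by
    intro v w x
    have hd : DifferentiableAt ℝ (fderiv ℝ φ) x :=
      ((h1.fderiv_right (m := ∞) (by simp)).differentiable (by simp)) x
    rw [fderiv_clm_apply hd (differentiableAt_const v)]
    simp
  have hsymm : ∀ x, fderiv ℝ (fun x => fderiv ℝ φ x ek) x ej
      = fderiv ℝ (fun x => fderiv ℝ φ x ej) x ek := by
    intro x
    rw [hd2, hd2]
    exact (h1.contDiffAt.isSymmSndFDerivAt (by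
      rw [minSmoothness_of_isRCLikeNormedField]
      exact WithTop.coe_le_coe.2 (le_top : (2 : ℕ∞) ≤ ⊤))) ej ek
  have a1 := h.2.2 _ (hdiff ek) (HasCompactSupport.fderiv_apply ℝ h2 ek)
    ((tsupport_fderiv_apply_subset ℝ ek).trans h3)
  have a2 := hk.2.2 _ (hdiff ej) (HasCompactSupport.fderiv_apply ℝ h2 ej)
    ((tsupport_fderiv_apply_subset ℝ ej).trans h3)
  have a3 : ∫ x in Ω, f x * fderiv ℝ (fun x => fderiv ℝ φ x ek) x ej
      = ∫ x in Ω, f x * fderiv ℝ (fun x => fderiv ℝ φ x ej) x ek := by simp only [hsymm]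
  simp only [zero_mul, integral_zero, neg_zero] at a2 ⊢
  have a4 : (∫ x in Ω, f x * fderiv ℝ (fun x => fderiv ℝ φ x ek) x ej)
      = -∫ x in Ω, g x * fderiv ℝ φ x ek := a1
  have a5 : ∫ x in Ω, f x * fderiv ℝ (fun x => fderiv ℝ φ x ej) x ek = 0 := a2
  linarith

end HasWeakPartial

/-! ### Functions with vanishing weak partial derivatives -/

open scoped Convolution

/-- A sequence of bump functions with shrinking supports. -/
noncomputable def shrinkingBump (m k : ℕ) : ContDiffBump (0 : Space m) where
  rIn := 1 / ((k : ℝ) + 1) / 2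
  rOut := 1 / ((k : ℝ) + 1)
  rIn_pos := by positivity
  rIn_lt_rOut := half_lt_self (by positivity)

/-- The mollification of `f` at scale `1 / (k + 1)`. -/
noncomputable def mollify {m : ℕ} (f : Space m → ℝ) (k : ℕ) : Space m → ℝ :=
  ((shrinkingBump m k).normed volume ⋆[ContinuousLinearMap.lsmul ℝ ℝ, volume] f)

/-- The representative of `f` obtained as the upper limit of its mollifications. Unlike `f` it is
determined pointwise by the class of `f`. -/
noncomputable def mollifiedRep {m : ℕ} (f : Space m → ℝ) (x : Space m) : ℝ :=
  limsup (fun k => mollify f k x) atTop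

theorem tendsto_shrinkingBump_rOut (m : ℕ) :
    Tendsto (fun k => (shrinkingBump m k).rOut) atTop (𝓝 0) :=
  tendsto_one_div_add_atTop_nhds_zero_nat

theorem mollifiedRep_ae_eq {m : ℕ} {f : Space m → ℝ} (hf : LocallyIntegrable f volume) :
    mollifiedRep f =ᵐ[volume] f := by
  have h := ContDiffBump.ae_convolution_tendsto_right_of_locallyIntegrable (K := 2)
    (tendsto_shrinkingBump_rOut m)
    (Eventually.of_forall fun k => by simp only [shrinkingBump]; linarith) hf
  filter_upwards [h] with x hx
  exact hx.limsup_eq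

theorem mollify_eq_flip {m : ℕ} (f : Space m → ℝ) (k : ℕ) :
    mollify f k = (f ⋆[(ContinuousLinearMap.lsmul ℝ ℝ).flip, volume]
      (shrinkingBump m k).normed volume) := by
  rw [mollify, ← convolution_flip]

theorem hasFDerivAt_mollify {m : ℕ} {f : Space m → ℝ} (hf : LocallyIntegrable f volume) (k : ℕ)
    (x : Space m) : ∃ L : Space m →L[ℝ] ℝ, HasFDerivAt (mollify f k) L x ∧
      ∀ v, L v = ∫ t, f t * fderiv ℝ ((shrinkingBump m k).normed volume) (x - t) v := by
  rw [mollify_eq_flip]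
  set ρ := (shrinkingBump m k).normed (volume : Measure (Space m)) with hρ
  have hc : HasCompactSupport ρ := (shrinkingBump m k).hasCompactSupport_normed
  have hd : ContDiff ℝ 1 ρ := (shrinkingBump m k).contDiff_normed (n := 1)
  refine ⟨_, hc.hasFDerivAt_convolution_right _ hf hd x, fun v => ?_⟩
  rw [convolution_precompR_apply _ hf (hc.fderiv ℝ) (hd.continuous_fderiv one_ne_zero),
    convolution_def]
  refine integral_congr_ae (Eventually.of_forall fun t => ?_)
  simp [mul_comm]

theorem measurable_mollifiedRep {m : ℕ} {f : Space m → ℝ} (hf : LocallyIntegrable f volume) :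
    Measurable (mollifiedRep f) := by
  refine Measurable.limsup fun k => Continuous.measurable ?_
  refine continuous_iff_continuousAt.2 fun x => ?_
  obtain ⟨L, hL, -⟩ := hasFDerivAt_mollify hf k x
  exact hL.continuousAt

theorem locallyIntegrable_indicator {m : ℕ} {Ω : Set (Space m)} (hΩ : IsOpen Ω) {f : Space m → ℝ}
    (hf : IntegrableOn f Ω volume) : LocallyIntegrable (Ω.indicator f) volume :=
  ((integrable_indicator_iff hΩ.measurableSet).2 hf).locallyIntegrable

theorem mollifiedRep_indicator_ae_eq {m : ℕ} {Ω : Set (Space m)} (hΩ : IsOpen Ω) {f : Space m → ℝ}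
    (hf : IntegrableOn f Ω volume) :
    mollifiedRep (Ω.indicator f) =ᵐ[volume.restrict Ω] f := by
  rw [Filter.EventuallyEq, ae_restrict_iff' hΩ.measurableSet]
  filter_upwards [mollifiedRep_ae_eq (locallyIntegrable_indicator hΩ hf)] with x hx hxΩ
  rw [hx, indicator_of_mem hxΩ]

/-- Where the mollification only sees `Ω`, it inherits a vanishing weak partial derivative. -/
theorem integral_indicator_mul_fderiv_bump_eq_zero {m : ℕ} {Ω : Set (Space m)} (hΩ : IsOpen Ω)
    {f : Space m → ℝ} {j : Fin (m + 1)} (hj : HasWeakPartial Ω j f fun _ => 0) {k : ℕ} {x : Space m}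
    (hx : Metric.closedBall x (shrinkingBump m k).rOut ⊆ Ω) :
    ∫ t, Ω.indicator f t * fderiv ℝ ((shrinkingBump m k).normed volume) (x - t)
      (EuclideanSpace.single j 1) = 0 := by
  set ρ := (shrinkingBump m k).normed (volume : Measure (Space m)) with hρ
  set e : Space m := EuclideanSpace.single j 1 with he
  have hd : ContDiff ℝ ∞ ρ := (shrinkingBump m k).contDiff_normed (n := ⊤)
  have hsub : ContDiff ℝ ∞ fun t : Space m => ρ (x - t) := hd.comp (contDiff_const.sub contDiff_id)
  have hts : tsupport (fun t : Space m => ρ (x - t)) ⊆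
      Metric.closedBall x (shrinkingBump m k).rOut := by
    refine closure_minimal (fun t ht => ?_) Metric.isClosed_closedBall
    have h1 : x - t ∈ Function.support ρ := ht
    rw [hρ, (shrinkingBump m k).support_normed_eq, mem_ball_zero_iff] at h1
    rw [Metric.mem_closedBall, dist_comm, dist_eq_norm]
    exact h1.le
  have hc : HasCompactSupport fun t : Space m => ρ (x - t) :=
    (isCompact_closedBall x _).of_isClosed_subset (isClosed_tsupport _) hts
  have key := hj.2.2 _ hsub hc (hts.trans hx)
  have hder : ∀ t, fderiv ℝ (fun t : Space m => ρ (x - t)) t e = -fderiv ℝ ρ (x - t) e := by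
    intro t
    have h1 : HasFDerivAt (fun t : Space m => x - t) (-ContinuousLinearMap.id ℝ (Space m)) t :=
      (hasFDerivAt_id t).const_sub x
    have h2 := ((hd.differentiable (by simp) (x - t)).hasFDerivAt.comp t h1).fderiv
    rw [Function.comp_def] at h2
    rw [h2]
    simp
  simp only [zero_mul, integral_zero, neg_zero] at key
  rw [← he] at key
  simp only [hder, mul_neg, integral_neg, neg_eq_zero] at key
  rw [← key, ← integral_indicator hΩ.measurableSet]
  refine integral_congr_ae (Eventually.of_forall fun t => ?_)
  by_cases ht : t ∈ Ω <;> simp [ht]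

/-- If the weak partial derivatives of `f` in the directions `j ∈ J` vanish on `Ω`, then the
representative of `f` is, near each point of `Ω`, unchanged when only the coordinates in `J` vary. -/
theorem exists_ball_mollifiedRep_eq {m : ℕ} {Ω : Set (Space m)} (hΩ : IsOpen Ω) {f : Space m → ℝ}
    (hf : IntegrableOn f Ω volume) {J : Set (Fin (m + 1))}
    (hJ : ∀ j ∈ J, HasWeakPartial Ω j f fun _ => 0) {x₀ : Space m} (hx₀ : x₀ ∈ Ω) :
    ∃ r > 0, ∀ x ∈ Metric.ball x₀ r, ∀ y ∈ Metric.ball x₀ r, (∀ j, j ∉ J → x j = y j) →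
      mollifiedRep (Ω.indicator f) x = mollifiedRep (Ω.indicator f) y := by
  obtain ⟨R, hR, hball⟩ := Metric.isOpen_iff.1 hΩ x₀ hx₀
  refine ⟨R / 2, by positivity, fun x hx y hy hxy => ?_⟩
  have hF := locallyIntegrable_indicator hΩ hf
  refine limsup_congr ?_
  filter_upwards [(tendsto_shrinkingBump_rOut m).eventually_lt_const (half_pos hR)] with k hk
  have hseg : ∀ z ∈ Metric.ball x₀ (R / 2),
      HasFDerivAt (mollify (Ω.indicator f) k) (fderiv ℝ (mollify (Ω.indicator f) k) z) z ∧
        fderiv ℝ (mollify (Ω.indicator f) k) z (x - y) = 0 := by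
    intro z hz
    obtain ⟨L, hL, hLv⟩ := hasFDerivAt_mollify hF k z
    rw [hL.fderiv]
    refine ⟨hL, ?_⟩
    have hzΩ : Metric.closedBall z (shrinkingBump m k).rOut ⊆ Ω := by
      refine Subset.trans (fun w hw => ?_) hball
      rw [Metric.mem_closedBall] at hw
      rw [Metric.mem_ball] at hz ⊢
      linarith [dist_triangle w z x₀]
    have hexp : x - y = ∑ j, (x j - y j) • (EuclideanSpace.single j 1 : Space m) := by
      ext i
      simp [Pi.single_apply]
    rw [hexp, map_sum]
    refine Finset.sum_eq_zero fun j _ => ?_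
    rw [map_smul]
    by_cases hjJ : j ∈ J
    · rw [hLv, integral_indicator_mul_fderiv_bump_eq_zero hΩ (hJ j hjJ) hzΩ, smul_zero]
    · rw [hxy j hjJ, sub_self, zero_smul]
  have hmem : ∀ s ∈ Icc (0 : ℝ) 1, y + s • (x - y) ∈ Metric.ball x₀ (R / 2) := by
    intro s hs
    have := (convex_ball x₀ (R / 2)).add_smul_sub_mem hy hx hs
    exact this
  have hder : ∀ s ∈ Icc (0 : ℝ) 1,
      HasDerivAt (fun s : ℝ => mollify (Ω.indicator f) k (y + s • (x - y))) 0 s := by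
    intro s hs
    obtain ⟨h1, h2⟩ := hseg _ (hmem s hs)
    have h3 : HasDerivAt (fun s : ℝ => y + s • (x - y)) (x - y) s := by
      simpa using ((hasDerivAt_id s).smul_const (x - y)).const_add y
    have h4 := h1.comp_hasDerivAt s h3
    rwa [h2] at h4
  have := constant_of_has_deriv_right_zero
    (fun s hs => (hder s hs).continuousAt.continuousWithinAt)
    (fun s hs => (hder s (Ico_subset_Icc_self hs)).hasDerivWithinAt) 1 (right_mem_Icc.2 zero_le_one)
  simpa using this

/-- A function on a connected open set all of whose weak partial derivatives vanish is constant. -/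
theorem exists_ae_eq_const_of_hasWeakPartial_zero {m : ℕ} {Ω : Set (Space m)} (hΩ : IsOpen Ω)
    (hconn : IsConnected Ω) {f : Space m → ℝ} (hf : IntegrableOn f Ω volume)
    (h : ∀ j, HasWeakPartial Ω j f fun _ => 0) : ∃ c, f =ᵐ[volume.restrict Ω] fun _ => c := by
  obtain ⟨x₀, hx₀⟩ := hconn.nonempty
  refine ⟨mollifiedRep (Ω.indicator f) x₀, ?_⟩
  filter_upwards [mollifiedRep_indicator_ae_eq hΩ hf, ae_restrict_mem hΩ.measurableSet]
    with x hx hxΩ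
  rw [← hx]
  refine hconn.isPreconnected.induction₂ (fun x y => mollifiedRep (Ω.indicator f) x
    = mollifiedRep (Ω.indicator f) y) (fun x hx => ?_) (fun _ _ _ _ _ _ => Eq.trans)
    (fun _ _ _ _ => Eq.symm) hxΩ hx₀
  obtain ⟨r, hr, hball⟩ := exists_ball_mollifiedRep_eq hΩ hf (J := univ) (fun j _ => h j) hx
  filter_upwards [mem_nhdsWithin_of_mem_nhds (Metric.ball_mem_nhds x hr)] with y hy
  exact hball x (Metric.mem_ball_self hr) y hy fun j hj => absurd (mem_univ j) hj

/-- On a domain with connected cross sections, a function whose horizontal weak derivatives vanish is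
a function of the height. -/
theorem exists_ae_eq_comp_height {m : ℕ} {Ω : Set (Space m)} (hΩ : IsOpen Ω)
    (hcross : IsCrossSectionConnected Ω) {a b : ℝ} (hab : IsHeightInterval Ω a b) {f : Space m → ℝ}
    (hf : IntegrableOn f Ω volume)
    (h : ∀ k : Fin m, HasWeakPartial Ω k.castSucc f fun _ => 0) :
    ∃ g : ℝ → ℝ, AEStronglyMeasurable g volume ∧ (∀ t, t ∉ Ioo a b → g t = 0) ∧
      f =ᵐ[volume.restrict Ω] fun x => g (height x) := by
  classical
  set F := mollifiedRep (Ω.indicator f) with hF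
  have hFm : Measurable F := measurable_mollifiedRep (locallyIntegrable_indicator hΩ hf)
  have hconst : ∀ x ∈ Ω, ∀ y ∈ Ω, height x = height y → F x = F y := by
    intro x hx y hy hxy
    refine (hcross (height x)).induction₂ (fun x y => F x = F y) (fun z hz => ?_)
      (fun _ _ _ _ _ _ => Eq.trans) (fun _ _ _ _ => Eq.symm) ⟨hx, rfl⟩ ⟨hy, hxy.symm⟩
    obtain ⟨r, hr, hball⟩ := exists_ball_mollifiedRep_eq hΩ hf (J := {j | j ≠ Fin.last m})
      (fun j hj => by
        obtain ⟨k, rfl⟩ := Fin.exists_castSucc_eq.2 hj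
        exact h k) hz.1
    filter_upwards [mem_nhdsWithin_of_mem_nhds (Metric.ball_mem_nhds z hr), self_mem_nhdsWithin]
      with w hw hw'
    refine hball z (Metric.mem_ball_self hr) w hw fun j hj => ?_
    have hj' : j = Fin.last m := not_not.1 hj
    have h1 : z (Fin.last m) = height x := hz.2
    have h2 : w (Fin.last m) = height x := hw'.2
    rw [hj', h1, h2]
  set g : ℝ → ℝ := fun t => if ht : ∃ x ∈ Ω, height x = t then F ht.choose else 0 with hg
  have hgF : ∀ x ∈ Ω, g (height x) = F x := by
    intro x hx
    have ht : ∃ y ∈ Ω, height y = height x := ⟨x, hx, rfl⟩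
    simp only [hg, dif_pos ht]
    exact hconst _ ht.choose_spec.1 _ hx ht.choose_spec.2
  have hg0 : ∀ t, t ∉ Ioo a b → g t = 0 := by
    intro t ht
    refine dif_neg ?_
    rintro ⟨x, hx, rfl⟩
    exact ht (hab.mem hx)
  have hmeas : AEMeasurable g (volume.restrict (Icc a b ∩ Ioo a b)) := by
    refine isCompact_Icc.induction_on
      (p := fun s : Set ℝ => AEMeasurable g (volume.restrict (s ∩ Ioo a b))) ?_ ?_ ?_ ?_
    · simp
    · exact fun s t hst ht => ht.mono_set (inter_subset_inter_left _ hst)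
    · intro s t hs ht
      rw [union_inter_distrib_right]
      exact aemeasurable_union_iff.2 ⟨hs, ht⟩
    · intro t ht
      obtain ⟨c, r, hr, hsub⟩ := hab.exists_cylinder t ht
      refine ⟨Ioo (t - r) (t + r), mem_nhdsWithin_of_mem_nhds
        (Ioo_mem_nhds (by linarith) (by linarith)), ?_⟩
      -- over the base point of the cylinder, `g` is the restriction of `F` to a vertical line
      set line : ℝ → Space m := fun s => c + (s - height c) • EuclideanSpace.single (Fin.last m) 1
      have hline : Continuous line := by fun_prop
      refine ⟨fun s => F (line s), hFm.comp hline.measurable, ?_⟩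
      refine ae_restrict_of_forall_mem (measurableSet_Ioo.inter measurableSet_Ioo) fun s hs => ?_
      have hh : height (line s) = s := by
        simp [line, height]
      have hmem : line s ∈ Ω := by
        refine hsub ⟨fun i => ?_, by rwa [hh]⟩
        simpa [line] using hr
      change g s = F (line s)
      rw [← hgF _ hmem, hh]
  rw [inter_eq_right.2 Ioo_subset_Icc_self] at hmeas
  have hgi : (Ioo a b).indicator g = g := by
    refine indicator_eq_self.2 fun t ht => ?_
    by_contra h'
    exact ht (hg0 t h')
  refine ⟨g, ?_, hg0, ?_⟩
  · rw [← hgi]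
    exact ((aemeasurable_indicator_iff measurableSet_Ioo).2 hmeas).aestronglyMeasurable
  · filter_upwards [mollifiedRep_indicator_ae_eq hΩ hf, ae_restrict_mem hΩ.measurableSet]
      with x hx hxΩ
    rw [hgF x hxΩ, ← hx]

/-- Integrability of a function of the height on `Ω` is integrability on the line. -/
theorem IsHeightInterval.memLp_of_comp_height {m : ℕ} {Ω : Set (Space m)} {a b : ℝ}
    (hab : IsHeightInterval Ω a b) (hΩ : Bornology.IsBounded Ω) {p : ℝ≥0∞} {g : ℝ → ℝ}
    (hg : AEStronglyMeasurable g volume) (hg0 : ∀ t, t ∉ Ioo a b → g t = 0)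
    (h : MemLp (fun x => g (height x)) p (volume.restrict Ω)) : MemLp g p volume := by
  obtain ⟨C, hC, hle⟩ := exists_map_height_le hΩ
  obtain ⟨D, hD, hge⟩ := hab.exists_restrict_le
  have hgm : AEStronglyMeasurable g ((volume.restrict Ω).map height) :=
    hg.mono_ac (Measure.absolutelyContinuous_of_le_smul hle)
  have h1 : MemLp g p ((volume.restrict Ω).map height) :=
    (memLp_map_measure_iff hgm measurable_height.aemeasurable).2 h
  have h2 : MemLp g p (volume.restrict (Ioo a b)) := h1.of_measure_le_smul hD hge
  rw [← memLp_indicator_iff_restrict measurableSet_Ioo] at h2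
  rwa [indicator_eq_self.2] at h2
  intro t ht
  by_contra h'
  exact ht (hg0 t h')

/-! ### Primitives in the height, and weak convergence in `L^p` -/

/-- A function on `Ω` depending only on the height, with weak derivatives in `L^p`, is the primitive of
its vertical derivative. -/
theorem exists_ae_eq_primitive_height {m : ℕ} {Ω : Set (Space m)} (hΩ : IsBoundedLipschitzDomain Ω)
    (hcross : IsCrossSectionConnected Ω) {a b : ℝ} (hab : IsHeightInterval Ω a b) {p : ℝ≥0∞}
    (hp : 1 ≤ p) {f g : Space m → ℝ} (hf : MemLp f p (volume.restrict Ω))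
    (hg : MemLp g p (volume.restrict Ω))
    (hk : ∀ k : Fin m, HasWeakPartial Ω k.castSucc f fun _ => 0)
    (hn : HasWeakPartial Ω (Fin.last m) f g) :
    ∃ (c : ℝ) (γ : ℝ → ℝ), MemLp γ p volume ∧ Integrable γ volume ∧ (∀ t, t ∉ Ioo a b → γ t = 0) ∧
      g =ᵐ[volume.restrict Ω] (fun x => γ (height x)) ∧
      f =ᵐ[volume.restrict Ω] fun x => c + ∫ t in a..height x, γ t := by
  have hfin : IsFiniteMeasure (volume.restrict Ω) :=
    ⟨by rw [Measure.restrict_apply_univ]; exact hΩ.isBounded.measure_lt_top⟩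
  have hgi : IntegrableOn g Ω volume := memLp_one_iff_integrable.1 (hg.mono_exponent hp)
  have hfi : IntegrableOn f Ω volume := memLp_one_iff_integrable.1 (hf.mono_exponent hp)
  obtain ⟨γ, hγm, hγ0, hγ⟩ := exists_ae_eq_comp_height hΩ.isOpen hcross hab hgi
    fun k => hn.partial_eq_zero (hk k)
  have hγp : MemLp γ p volume :=
    hab.memLp_of_comp_height hΩ.isBounded hγm hγ0 (hg.ae_eq hγ)
  have hγ1 : Integrable γ volume := memLp_one_iff_integrable.1
    (hab.memLp_of_comp_height hΩ.isBounded hγm hγ0 (memLp_one_iff_integrable.2 (hgi.congr hγ)))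
  set G : ℝ → ℝ := fun t => ∫ s in a..t, γ s with hG
  have hGs : ∀ s t, G t - G s = ∫ r in s..t, γ r := fun s t =>
    intervalIntegral.integral_interval_sub_left hγ1.intervalIntegrable hγ1.intervalIntegrable
  have hGw : ∀ j, HasWeakPartial Ω j (fun x => G (height x))
      (fun x => if j = Fin.last m then γ (height x) else 0) := by
    intro j
    have := hasWeakPartial_comp_height_mul Ω hγ1 hGs (contDiff_const (c := (1 : ℝ))) j
    simpa using this
  have hdiff : ∀ j, HasWeakPartial Ω j (fun x => f x - G (height x)) fun _ => 0 := by
    intro j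
    by_cases hj : j = Fin.last m
    · subst hj
      refine (hn.sub (hGw _)).congr_ae EventuallyEq.rfl ?_
      filter_upwards [hγ] with x hx
      simp [hx]
    · obtain ⟨k, rfl⟩ := Fin.exists_castSucc_eq.2 hj
      simpa [hj] using (hk k).sub (hGw k.castSucc)
  have hGc : Continuous fun x : Space m => G (height x) :=
    (continuous_of_sub_eq_integral hγ1 hGs).comp continuous_height
  have hGi : IntegrableOn (fun x : Space m => G (height x)) Ω volume :=
    (hGc.locallyIntegrable.integrableOn_isCompact hΩ.isBounded.isCompact_closure).mono_set
      subset_closure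
  obtain ⟨c, hc⟩ := exists_ae_eq_const_of_hasWeakPartial_zero hΩ.isOpen hΩ.isConnected
    (hfi.sub hGi) hdiff
  refine ⟨c, γ, hγp, hγ1, hγ0, hγ, ?_⟩
  filter_upwards [hc] with x hx
  have hx' : f x - G (height x) = c := hx
  rw [← hx']
  simp [hG]

open scoped Manifold in
/-- Smooth functions compactly supported in `Ω` are dense in `L^q(Ω)`, `q < ∞`. -/
theorem exists_contDiff_tsupport_subset_eLpNorm_sub_le {m : ℕ} {Ω : Set (Space m)} (hΩ : IsOpen Ω)
    (hfin : volume Ω ≠ ⊤) {q : ℝ≥0∞} (hq1 : 1 ≤ q) (hq2 : q ≠ ⊤) {h : Space m → ℝ}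
    (hh : MemLp h q (volume.restrict Ω)) {δ : ℝ} (hδ : 0 < δ) :
    ∃ ψ : Space m → ℝ, ContDiff ℝ ∞ ψ ∧ HasCompactSupport ψ ∧ tsupport ψ ⊆ Ω ∧
      eLpNorm (h - ψ) q (volume.restrict Ω) ≤ ENNReal.ofReal δ := by
  obtain ⟨η, hη0, hη⟩ := hh.eLpNorm_indicator_le hq1 hq2 (half_pos hδ)
  obtain ⟨K, hKΩ, hK, hKη⟩ := hΩ.measurableSet.exists_isCompact_sdiff_lt hfin
    (ENNReal.ofReal_pos.2 hη0).ne'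
  obtain ⟨K', hK', hKK', hK'Ω⟩ := exists_compact_between hK hΩ hKΩ
  obtain ⟨χ, hχ0, hχ1, hχ⟩ := exists_contMDiffMap_zero_one_of_isClosed (n := ⊤) 𝓘(ℝ, Space m)
    (isOpen_interior (s := K')).isClosed_compl hK.isClosed
    (disjoint_compl_left_iff_subset.2 hKK')
  have hχs : tsupport (χ : Space m → ℝ) ⊆ K' := by
    refine closure_minimal (fun x hx => ?_) hK'.isClosed
    by_contra hxK
    exact hx (hχ0 fun h => hxK (interior_subset h))
  have hχc : ContDiff ℝ ∞ (χ : Space m → ℝ) := χ.contMDiff.contDiff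
  obtain ⟨ψ, hψc, hψ, hψh⟩ := hh.exist_eLpNorm_sub_le hq2 hq1 (half_pos hδ)
  have hsub : tsupport (fun x => χ x * ψ x) ⊆ tsupport (χ : Space m → ℝ) :=
    closure_mono fun x hx => left_ne_zero_of_mul hx
  refine ⟨fun x => χ x * ψ x, hχc.mul hψ, hψc.mul_left, hsub.trans (hχs.trans hK'Ω), ?_⟩
  have e : (h - fun x => χ x * ψ x) = (fun x => (1 - χ x) * h x) + fun x => χ x * (h x - ψ x) := by
    ext x; simp only [Pi.sub_apply, Pi.add_apply]; ring
  have m1 : AEStronglyMeasurable (fun x => (1 - χ x) * h x) (volume.restrict Ω) :=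
    ((continuous_const.sub hχc.continuous).aestronglyMeasurable).mul hh.1
  have m2 : AEStronglyMeasurable (fun x => χ x * (h x - ψ x)) (volume.restrict Ω) :=
    hχc.continuous.aestronglyMeasurable.mul (hh.1.sub hψ.continuous.aestronglyMeasurable)
  rw [e, ← add_halves δ, ENNReal.ofReal_add (half_pos hδ).le (half_pos hδ).le]
  refine (eLpNorm_add_le m1 m2 hq1).trans (add_le_add ?_ (le_trans ?_ hψh))
  · refine le_trans ?_ (hη (Ω \ K) (hΩ.measurableSet.diff hK.measurableSet) ?_)
    · refine eLpNorm_mono_ae ?_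
      filter_upwards [ae_restrict_mem hΩ.measurableSet] with x hx
      by_cases hxK : x ∈ K
      · have : χ x = 1 := hχ1 hxK
        simp [this]
      · rw [indicator_of_mem (show x ∈ Ω \ K from ⟨hx, hxK⟩), norm_mul]
        refine mul_le_of_le_one_left (norm_nonneg _) ?_
        rw [Real.norm_eq_abs, abs_le]
        constructor <;> linarith [(hχ x).1, (hχ x).2]
    · exact (Measure.restrict_apply_le _ _).trans hKη.le
  · refine eLpNorm_mono fun x => ?_
    rw [norm_mul]
    refine mul_le_of_le_one_left (norm_nonneg _) ?_
    rw [Real.norm_eq_abs, abs_le]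
    constructor <;> linarith [(hχ x).1, (hχ x).2]

theorem enorm_integral_mul_le {α : Type*} [MeasurableSpace α] {μ : Measure α} {p q : ℝ≥0∞}
    (hpq : p⁻¹ + q⁻¹ = 1) {f g : α → ℝ} (hf : MemLp f p μ) (hg : MemLp g q μ) :
    Integrable (fun x => f x * g x) μ ∧
      ‖∫ x, f x * g x ∂μ‖ₑ ≤ eLpNorm f p μ * eLpNorm g q μ := by
  have : ENNReal.HolderTriple p q 1 := ⟨by rw [hpq, inv_one]⟩
  refine ⟨hf.integrable_mul hg, ?_⟩
  refine (enorm_integral_le_lintegral_enorm _).trans ?_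
  rw [← eLpNorm_one_eq_lintegral_enorm]
  have h : eLpNorm (f • g) 1 μ ≤ eLpNorm f p μ * eLpNorm g q μ :=
    eLpNorm_smul_le_mul_eLpNorm hg.1 hf.1
  exact h

/-- Strong convergence in `L^p` implies weak convergence. -/
theorem weakConvLp_of_tendsto_eLpNorm {m : ℕ} {Ω : Set (Space m)} {p : ℝ≥0∞}
    {F : ℝ → Space m → ℝ} {f : Space m → ℝ} (hF : ∀ ε > 0, MemLp (F ε) p (volume.restrict Ω))
    (hf : MemLp f p (volume.restrict Ω))
    (h : Tendsto (fun ε => eLpNorm (F ε - f) p (volume.restrict Ω)) (𝓝[>] 0) (𝓝 0)) :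
    WeakConvLp Ω p F f := by
  refine ⟨hF, hf, fun q hpq g hg => ?_⟩
  rw [tendsto_iff_edist_tendsto_0]
  have hlim : Tendsto (fun ε => eLpNorm (F ε - f) p (volume.restrict Ω)
      * eLpNorm g q (volume.restrict Ω)) (𝓝[>] 0) (𝓝 0) := by
    simpa using ENNReal.Tendsto.mul_const h (Or.inr hg.eLpNorm_ne_top)
  refine tendsto_of_tendsto_of_tendsto_of_le_of_le' tendsto_const_nhds hlim
    (Eventually.of_forall fun _ => zero_le) ?_
  filter_upwards [self_mem_nhdsWithin] with ε hε
  rw [edist_eq_enorm_sub, ← integral_sub (enorm_integral_mul_le hpq (hF ε hε) hg).1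
    (enorm_integral_mul_le hpq hf hg).1]
  simp only [← sub_mul]
  exact (enorm_integral_mul_le hpq ((hF ε hε).sub hf) hg).2

/-- If `f_ε ⇀ f` in `L^p` and the weak derivatives `∂_j f_ε` are bounded in `L^p`, then they converge
weakly to `∂_j f`: pairings with test functions converge by definition of the weak derivative. -/
theorem weakConvLp_of_hasWeakPartial {m : ℕ} {Ω : Set (Space m)} (hΩ : IsOpen Ω)
    (hfin : volume Ω ≠ ⊤) {p : ℝ≥0∞} (hp1 : 1 < p) {j : Fin (m + 1)} {F G : ℝ → Space m → ℝ}
    {f g : Space m → ℝ} (hF : WeakConvLp Ω p F f) (hFG : ∀ ε > 0, HasWeakPartial Ω j (F ε) (G ε))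
    (hfg : HasWeakPartial Ω j f g) (hG : ∀ ε > 0, MemLp (G ε) p (volume.restrict Ω))
    (hg : MemLp g p (volume.restrict Ω)) {M : ℝ≥0∞} (hM : M ≠ ⊤)
    (hbound : ∀ᶠ ε in 𝓝[>] (0 : ℝ), eLpNorm (G ε) p (volume.restrict Ω) ≤ M) :
    WeakConvLp Ω p G g := by
  refine ⟨hG, hg, fun q hpq h hh => ?_⟩
  have hq2 : q ≠ ⊤ := by
    rintro rfl
    rw [ENNReal.inv_top, add_zero, ENNReal.inv_eq_one] at hpq
    exact hp1.ne' hpq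
  have hq1 : 1 ≤ q := by
    rw [← ENNReal.inv_le_one, ← hpq]
    exact le_add_self
  set B := M + eLpNorm g p (volume.restrict Ω) with hB
  have hBtop : B ≠ ⊤ := ENNReal.add_ne_top.2 ⟨hM, hg.eLpNorm_ne_top⟩
  rw [Metric.tendsto_nhds]
  intro η hη
  set δ := η / 2 / (B.toReal + 1) with hδdef
  have hδ : 0 < δ := by positivity
  obtain ⟨ψ, h1, h2, h3, hψ⟩ := exists_contDiff_tsupport_subset_eLpNorm_sub_le hΩ hfin hq1 hq2 hh hδ
  have hψq : MemLp ψ q (volume.restrict Ω) := h1.continuous.memLp_of_hasCompactSupport h2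
  have hψ'q : MemLp (fun x => fderiv ℝ ψ x (EuclideanSpace.single j 1)) q (volume.restrict Ω) :=
    (continuous_fderiv_apply_const h1 _).memLp_of_hasCompactSupport (h2.fderiv_apply ℝ _)
  have htest : Tendsto (fun ε => ∫ x in Ω, G ε x * ψ x) (𝓝[>] 0) (𝓝 (∫ x in Ω, g x * ψ x)) := by
    have := (hF.2.2 q hpq _ hψ'q).neg
    rw [hfg.2.2 ψ h1 h2 h3, neg_neg] at this
    refine this.congr' ?_
    filter_upwards [self_mem_nhdsWithin] with ε hε
    rw [(hFG ε hε).2.2 ψ h1 h2 h3, neg_neg]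
  filter_upwards [Metric.tendsto_nhds.1 htest (η / 2) (half_pos hη), self_mem_nhdsWithin, hbound]
    with ε hε hε0 hεM
  have hGε := hG ε hε0
  have I1 := (enorm_integral_mul_le hpq hGε hh).1
  have I2 := (enorm_integral_mul_le hpq hg hh).1
  have I3 := (enorm_integral_mul_le hpq hGε hψq).1
  have I4 := (enorm_integral_mul_le hpq hg hψq).1
  have hrest := (enorm_integral_mul_le hpq (hGε.sub hg) (hh.sub hψq)).2
  have e : ∫ x in Ω, (G ε - g) x * (h - ψ) x
      = ((∫ x in Ω, G ε x * h x) - ∫ x in Ω, g x * h x)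
        - ((∫ x in Ω, G ε x * ψ x) - ∫ x in Ω, g x * ψ x) := by
    rw [← integral_sub I1 I2, ← integral_sub I3 I4]
    refine Eq.trans ?_ (integral_sub (I1.sub I2) (I3.sub I4))
    refine integral_congr_ae (Eventually.of_forall fun x => ?_)
    simp only [Pi.sub_apply]
    ring
  have hrest' : |∫ x in Ω, (G ε - g) x * (h - ψ) x| ≤ B.toReal * δ := by
    have h5 : ‖∫ x in Ω, (G ε - g) x * (h - ψ) x‖ₑ ≤ B * ENNReal.ofReal δ := by
      refine hrest.trans (mul_le_mul' ?_ hψ)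
      exact (eLpNorm_sub_le hGε.1 hg.1 hp1.le).trans (add_le_add_left hεM _)
    have h6 := ENNReal.toReal_mono (ENNReal.mul_ne_top hBtop ENNReal.ofReal_ne_top) h5
    rwa [toReal_enorm, ENNReal.toReal_mul, ENNReal.toReal_ofReal hδ.le, Real.norm_eq_abs] at h6
  have hlt : B.toReal * δ < η / 2 := by
    rw [hδdef, mul_div_assoc', div_lt_iff₀ (by positivity)]
    nlinarith
  rw [Real.dist_eq] at hε ⊢
  rw [e] at hrest'
  have t1 := abs_lt.1 hε
  have t2 := abs_le.1 hrest'
  rw [abs_lt]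
  constructor <;> linarith [t1.1, t1.2, t2.1, t2.2]

/-! ### Layer deformations and their profiles -/

theorem layeredField_apply {m : ℕ} (c : ℝ) (R S : Space m → Mat m) (d : Space m → Space m)
    (x : Space m) (i j : Fin (m + 1)) :
    layeredField c R S d x i j
      = R x i j + if j = Fin.last m then c * (∑ k, S x i k * x k + d x i) else 0 := by
  simp only [layeredField, Matrix.add_apply, Matrix.smul_apply, Matrix.vecMulVec_apply,
    Pi.single_apply, Matrix.mulVec, dotProduct, smul_eq_mul]
  split_ifs
  · ring
  · simp

/-- The deformation `x ↦ R(x_n) x + D(x_n)`, which moves every horizontal layer rigidly when `R` takes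
values in the rotations. -/
noncomputable def layerDeformation {m : ℕ} (R : ℝ → Mat m) (D : ℝ → Space m) (x : Space m) : Space m :=
  WithLp.toLp 2 (R (height x) *ᵥ x.ofLp) + D (height x)

theorem layerDeformation_apply {m : ℕ} (R : ℝ → Mat m) (D : ℝ → Space m) (x : Space m)
    (i : Fin (m + 1)) :
    layerDeformation R D x i = ∑ k, R (height x) i k * x k + D (height x) i := rfl

/-- One-dimensional profiles of a layer deformation: `R` and `D` are primitives of the integrable and
`p`-integrable functions `σ` and `δ`. -/
structure IsProfile {m : ℕ} (p : ℝ≥0∞) (R σ : ℝ → Mat m) (D δ : ℝ → Space m) : Prop where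
  memLp_rot : ∀ i j, MemLp (fun t => σ t i j) p volume
  integrable_rot : ∀ i j, Integrable (fun t => σ t i j) volume
  rot_sub : ∀ i j s t, R t i j - R s i j = ∫ r in s..t, σ r i j
  memLp_shift : ∀ i, MemLp (fun t => δ t i) p volume
  integrable_shift : ∀ i, Integrable (fun t => δ t i) volume
  shift_sub : ∀ i s t, D t i - D s i = ∫ r in s..t, δ r i

namespace IsProfile

variable {m : ℕ} {p : ℝ≥0∞} {R σ : ℝ → Mat m} {D δ : ℝ → Space m}

theorem continuous_rot (h : IsProfile p R σ D δ) (i j : Fin (m + 1)) :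
    Continuous fun t => R t i j :=
  continuous_of_sub_eq_integral (h.integrable_rot i j) (h.rot_sub i j)

theorem continuous_shift (h : IsProfile p R σ D δ) (i : Fin (m + 1)) :
    Continuous fun t => D t i :=
  continuous_of_sub_eq_integral (h.integrable_shift i) (h.shift_sub i)

theorem hasWeakPartial_rot (h : IsProfile p R σ D δ) (Ω : Set (Space m)) (i k j : Fin (m + 1)) :
    HasWeakPartial Ω j (fun x => R (height x) i k)
      (fun x => if j = Fin.last m then σ (height x) i k else 0) := by
  simpa using hasWeakPartial_comp_height_mul Ω (h.integrable_rot i k) (h.rot_sub i k)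
    (contDiff_const (c := (1 : ℝ))) j

/-- The gradient of `R(x_n) x + D(x_n)` is `R + (R' x + D') ⊗ e_n`. -/
theorem hasWeakGradient (h : IsProfile p R σ D δ) (Ω : Set (Space m)) :
    HasWeakGradient Ω (layerDeformation R D) (layeredField 1 (fun x => R (height x))
      (fun x => σ (height x)) (fun x => δ (height x))) := by
  intro i j
  have h1 : ∀ k, HasWeakPartial Ω j (fun x => R (height x) i k * x k) (fun x =>
      (if j = Fin.last m then σ (height x) i k else 0) * x k
        + R (height x) i k * if k = j then 1 else 0) := by
    intro k
    have hk : ContDiff ℝ ∞ (fun x : Space m => x k) :=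
      (EuclideanSpace.proj k : Space m →L[ℝ] ℝ).contDiff
    have hd : ∀ x : Space m, fderiv ℝ (fun x : Space m => x k) x (EuclideanSpace.single j 1)
        = if k = j then 1 else 0 := by
      intro x
      have : fderiv ℝ (fun x : Space m => x k) x = EuclideanSpace.proj k :=
        (EuclideanSpace.proj k : Space m →L[ℝ] ℝ).fderiv
      rw [this]
      simp
    have := hasWeakPartial_comp_height_mul Ω (h.integrable_rot i k) (h.rot_sub i k) hk j
    simpa only [hd] using this
  have h2 : HasWeakPartial Ω j (fun x => D (height x) i)
      (fun x => if j = Fin.last m then δ (height x) i else 0) := by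
    simpa using hasWeakPartial_comp_height_mul Ω (h.integrable_shift i) (h.shift_sub i)
      (contDiff_const (c := (1 : ℝ))) j
  have h3 := (HasWeakPartial.sum Finset.univ fun k _ => h1 k).add h2
  refine h3.congr_ae EventuallyEq.rfl (Eventually.of_forall fun x => ?_)
  simp only [layeredField_apply, Finset.sum_add_distrib, mul_ite, mul_one, mul_zero,
    Finset.sum_ite_eq', Finset.mem_univ, if_true]
  split_ifs
  · ring
  · simp

end IsProfile

/-- The derivative of `F ∘ θ` when `F' = f` and `θ` is a layer map of speed `Λ` on `A`. -/
noncomputable def layerDeriv {E : Type*} [AddCommGroup E] [Module ℝ E] (Λ : ℝ) (A : Set ℝ)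
    (θ : ℝ → ℝ) (f : ℝ → E) : ℝ → E :=
  A.indicator fun t => Λ • f (θ t)

theorem layerDeriv_matrix_apply {m : ℕ} (Λ : ℝ) (A : Set ℝ) (θ : ℝ → ℝ) (f : ℝ → Mat m) (t : ℝ)
    (i j : Fin (m + 1)) :
    layerDeriv Λ A θ f t i j = A.indicator (fun t => Λ * f (θ t) i j) t := by
  by_cases ht : t ∈ A <;> simp [layerDeriv, ht]

theorem layerDeriv_vector_apply {m : ℕ} (Λ : ℝ) (A : Set ℝ) (θ : ℝ → ℝ) (f : ℝ → Space m) (t : ℝ)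
    (i : Fin (m + 1)) :
    layerDeriv Λ A θ f t i = A.indicator (fun t => Λ * f (θ t) i) t := by
  by_cases ht : t ∈ A <;> simp [layerDeriv, ht]

theorem IsLayerMap.sub_comp {Λ ε : ℝ} {A : Set ℝ} {θ : ℝ → ℝ} (hθ : IsLayerMap Λ ε A θ)
    {f F : ℝ → ℝ} (hf : Integrable f volume) (hF : ∀ s t, F t - F s = ∫ r in s..t, f r) (s t : ℝ) :
    F (θ t) - F (θ s) = ∫ r in s..t, A.indicator (fun r => Λ * f (θ r)) r := by
  rcases le_total s t with hst | hst
  · rw [hθ.integral_comp hf.1 hst, hF]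
  · rw [intervalIntegral.integral_symm, hθ.integral_comp hf.1 hst, ← hF]
    ring

/-- Slowing down a profile by a layer map gives a profile, with derivatives `layerDeriv`. -/
theorem IsProfile.comp {m : ℕ} {p : ℝ≥0∞} {R σ : ℝ → Mat m} {D δ : ℝ → Space m}
    (h : IsProfile p R σ D δ) {Λ ε : ℝ} (hΛ : 1 ≤ Λ) {A : Set ℝ} {θ : ℝ → ℝ}
    (hθ : IsLayerMap Λ ε A θ) :
    IsProfile p (R ∘ θ) (layerDeriv Λ A θ σ) (D ∘ θ) (layerDeriv Λ A θ δ) where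
  memLp_rot i j := by
    simp only [layerDeriv_matrix_apply]
    exact hθ.memLp_indicator_comp hΛ (h.memLp_rot i j)
  integrable_rot i j := by
    simp only [layerDeriv_matrix_apply]
    exact memLp_one_iff_integrable.1
      (hθ.memLp_indicator_comp hΛ (memLp_one_iff_integrable.2 (h.integrable_rot i j)))
  rot_sub i j s t := by
    simp only [layerDeriv_matrix_apply]
    exact hθ.sub_comp (h.integrable_rot i j) (h.rot_sub i j) s t
  memLp_shift i := by
    simp only [layerDeriv_vector_apply]
    exact hθ.memLp_indicator_comp hΛ (h.memLp_shift i)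
  integrable_shift i := by
    simp only [layerDeriv_vector_apply]
    exact memLp_one_iff_integrable.1
      (hθ.memLp_indicator_comp hΛ (memLp_one_iff_integrable.2 (h.integrable_shift i)))
  shift_sub i s t := by
    simp only [layerDeriv_vector_apply]
    exact hθ.sub_comp (h.integrable_shift i) (h.shift_sub i) s t

theorem isClosed_specialOrthogonalGroup (n : ℕ) :
    IsClosed (Matrix.specialOrthogonalGroup (Fin n) ℝ : Set (Matrix (Fin n) (Fin n) ℝ)) := by
  have h : (Matrix.specialOrthogonalGroup (Fin n) ℝ : Set (Matrix (Fin n) (Fin n) ℝ))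
      = {A | A * star A = 1} ∩ {A | A.det = 1} := by
    ext A
    rw [SetLike.mem_coe, Matrix.mem_specialOrthogonalGroup_iff, Matrix.mem_orthogonalGroup_iff]
    rfl
  rw [h]
  refine (isClosed_eq ?_ continuous_const).inter (isClosed_eq ?_ continuous_const)
  · exact continuous_id.matrix_mul continuous_id.matrix_conjTranspose
  · exact continuous_id.matrix_det

/-- A rotation field given a.e. on `Ω` by a profile that is stationary off `(a, b)` has a profile with
values in the rotations at every height. -/
theorem IsProfile.rot_mem {m : ℕ} {p : ℝ≥0∞} {R σ : ℝ → Mat m} {D δ : ℝ → Space m}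
    (h : IsProfile p R σ D δ) {Ω : Set (Space m)} {a b : ℝ} (hab : IsHeightInterval Ω a b)
    (hσ : ∀ t, t ∉ Ioo a b → σ t = 0)
    (hSO : ∀ᵐ x ∂(volume.restrict Ω), R (height x) ∈ Matrix.specialOrthogonalGroup (Fin (m + 1)) ℝ)
    (t : ℝ) : R t ∈ Matrix.specialOrthogonalGroup (Fin (m + 1)) ℝ := by
  have hRc : Continuous R := continuous_matrix fun i j => h.continuous_rot i j
  set Z : Set ℝ := R ⁻¹' (Matrix.specialOrthogonalGroup (Fin (m + 1)) ℝ : Set (Mat m)) with hZ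
  have hZc : IsClosed Z := (isClosed_specialOrthogonalGroup (m + 1)).preimage hRc
  obtain ⟨C, hC, hle⟩ := hab.exists_restrict_le
  have h1 : ∀ᵐ s ∂((volume.restrict Ω).map height), s ∈ Z :=
    (ae_map_iff measurable_height.aemeasurable hZc.measurableSet).2 hSO
  have h2 : ∀ᵐ s ∂(volume.restrict (Ioo a b)), s ∈ Z :=
    (Measure.absolutelyContinuous_of_le_smul hle).ae_le h1
  have h3 : Ioo a b ⊆ Z := by
    rw [ae_iff, Measure.restrict_apply' measurableSet_Ioo] at h2
    have hopen : IsOpen ({s | s ∉ Z} ∩ Ioo a b) := hZc.isOpen_compl.inter isOpen_Ioo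
    rw [IsOpen.measure_eq_zero_iff (μ := (volume : Measure ℝ)) hopen] at h2
    intro s hs
    by_contra hsZ
    exact (h2 ▸ (⟨hsZ, hs⟩ : s ∈ {s | s ∉ Z} ∩ Ioo a b) : s ∈ (∅ : Set ℝ))
  have h4 : Icc a b ⊆ Z := by
    rw [← closure_Ioo hab.lt.ne]
    exact closure_minimal h3 hZc
  have hconst : ∀ s t : ℝ, (∀ r ∈ uIcc s t, r ∉ Ioo a b) → R t = R s := by
    intro s t hst
    ext i j
    rw [← sub_eq_zero, h.rot_sub, intervalIntegral.integral_congr (g := fun _ => 0)]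
    · simp
    · intro r hr
      simp [hσ r (hst r hr)]
  rcases lt_or_ge t a with hta | hta
  · rw [hconst a t fun r hr hr' => ?_]
    · exact h4 (left_mem_Icc.2 hab.lt.le)
    · rw [uIcc_of_ge hta.le] at hr
      exact absurd hr.2 (not_le.2 hr'.1)
  rcases le_or_gt t b with htb | htb
  · exact h4 ⟨hta, htb⟩
  · rw [hconst b t fun r hr hr' => ?_]
    · exact h4 (right_mem_Icc.2 hab.lt.le)
    · rw [uIcc_of_le htb.le] at hr
      exact absurd hr.1 (not_le.2 hr'.2)

/-- The layered form of the limit: `u(x) = R(x_n) x + D(x_n)` with one-dimensional profiles. -/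
theorem exists_isProfile {m : ℕ} {p : ℝ≥0∞} (hp1 : 1 ≤ p)
    {Ω : Set (Space m)} (hΩ : IsBoundedLipschitzDomain Ω) (hcross : IsCrossSectionConnected Ω)
    {a b : ℝ} (hab : IsHeightInterval Ω a b)
    {u : Space m → Space m} {R S : Space m → Mat m} {d : Space m → Space m}
    (hu : ∀ i, MemW1p Ω p (fun x => u x i)) (hR : ∀ i j, MemW1p Ω p (fun x => R x i j))
    (hRSO : ∀ᵐ x ∂(volume.restrict Ω), R x ∈ Matrix.specialOrthogonalGroup (Fin (m + 1)) ℝ)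
    (hR' : ∀ i j, ∀ k : Fin m, HasWeakPartial Ω k.castSucc (fun x => R x i j) (fun _ => 0))
    (hRn : ∀ i j, HasWeakPartial Ω (Fin.last m) (fun x => R x i j) (fun x => S x i j))
    (hd : MemLp d p (volume.restrict Ω))
    (hd' : ∀ i, ∀ k : Fin m, HasWeakPartial Ω k.castSucc (fun x => d x i) (fun _ => 0))
    (hgrad : HasWeakGradient Ω u (layeredField 1 R S d)) :
    ∃ (P σ : ℝ → Mat m) (D δ : ℝ → Space m), IsProfile p P σ D δ ∧
      (∀ t, P t ∈ Matrix.specialOrthogonalGroup (Fin (m + 1)) ℝ) ∧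
      (R =ᵐ[volume.restrict Ω] fun x => P (height x)) ∧
      (S =ᵐ[volume.restrict Ω] fun x => σ (height x)) ∧
      (d =ᵐ[volume.restrict Ω] fun x => δ (height x)) ∧
      u =ᵐ[volume.restrict Ω] layerDeformation P D := by
  have hfin : IsFiniteMeasure (volume.restrict Ω) :=
    ⟨by rw [Measure.restrict_apply_univ]; exact hΩ.isBounded.measure_lt_top⟩
  have hS : ∀ i j, MemLp (fun x => S x i j) p (volume.restrict Ω) := by
    intro i j
    obtain ⟨g, hg, hgp⟩ := (hR i j).2 (Fin.last m)
    exact hgp.ae_eq (hg.ae_eq hΩ.isOpen (hRn i j))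
  choose c σ hσp hσ1 hσ0 hSσ hRσ using fun i j =>
    exists_ae_eq_primitive_height hΩ hcross hab hp1 (hR i j).1 (hS i j) (hR' i j) (hRn i j)
  have hdi : ∀ i, MemLp (fun x => d x i) p (volume.restrict Ω) := fun i =>
    (EuclideanSpace.proj i : Space m →L[ℝ] ℝ).comp_memLp' hd
  have hdint : ∀ i, IntegrableOn (fun x => d x i) Ω volume := fun i =>
    memLp_one_iff_integrable.1 ((hdi i).mono_exponent hp1)
  choose δ hδm hδ0 hdδ using fun i =>
    exists_ae_eq_comp_height hΩ.isOpen hcross hab (hdint i) (hd' i)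
  have hδp : ∀ i, MemLp (δ i) p volume := fun i =>
    hab.memLp_of_comp_height hΩ.isBounded (hδm i) (hδ0 i) ((hdi i).ae_eq (hdδ i))
  have hδ1 : ∀ i, Integrable (δ i) volume := fun i => memLp_one_iff_integrable.1
    (hab.memLp_of_comp_height hΩ.isBounded (hδm i) (hδ0 i)
      (memLp_one_iff_integrable.2 ((hdint i).congr (hdδ i))))
  set P : ℝ → Mat m := fun t => Matrix.of fun i j => c i j + ∫ s in a..t, σ i j s with hP
  set T : ℝ → Mat m := fun t => Matrix.of fun i j => σ i j t with hT
  set Δ : ℝ → Space m := fun t => WithLp.toLp 2 fun i => δ i t with hΔ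
  have hprim : ∀ {f : ℝ → ℝ}, Integrable f volume → ∀ (c s t : ℝ),
      (c + ∫ r in a..t, f r) - (c + ∫ r in a..s, f r) = ∫ r in s..t, f r := by
    intro f hf c s t
    rw [add_sub_add_left_eq_sub]
    exact intervalIntegral.integral_interval_sub_left hf.intervalIntegrable hf.intervalIntegrable
  have hprof : ∀ e : Fin (m + 1) → ℝ,
      IsProfile p P T (fun t => WithLp.toLp 2 fun i => e i + ∫ s in a..t, δ i s) Δ := fun e =>
    ⟨hσp, hσ1, fun i j => hprim (hσ1 i j) _, hδp, hδ1, fun i => hprim (hδ1 i) _⟩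
  have hRP : R =ᵐ[volume.restrict Ω] fun x => P (height x) := by
    filter_upwards [ae_all_iff.2 fun i => ae_all_iff.2 fun j => hRσ i j] with x hx
    ext i j
    exact hx i j
  have hSS : S =ᵐ[volume.restrict Ω] fun x => T (height x) := by
    filter_upwards [ae_all_iff.2 fun i => ae_all_iff.2 fun j => hSσ i j] with x hx
    ext i j
    exact hx i j
  have hdd : d =ᵐ[volume.restrict Ω] fun x => Δ (height x) := by
    filter_upwards [ae_all_iff.2 fun i => hdδ i] with x hx
    ext i
    exact hx i
  -- `u` and the layer deformation have the same gradient, so they differ by a constant vector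
  set w := layerDeformation P (fun t => WithLp.toLp 2 fun i => 0 + ∫ s in a..t, δ i s) with hw
  have hwg := (hprof fun _ => 0).hasWeakGradient Ω
  have hdiff : ∀ i j, HasWeakPartial Ω j (fun x => u x i - w x i) fun _ => 0 := by
    intro i j
    refine ((hgrad i j).sub (hwg i j)).congr_ae EventuallyEq.rfl ?_
    filter_upwards [hRP, hSS, hdd] with x h1 h2 h3
    simp only [layeredField_apply, h1, h2, h3, sub_self]
  have hwc : ∀ i, Continuous fun x => w x i := by
    intro i
    have h0 := hprof fun _ => 0
    have hx : ∀ k, Continuous fun x : Space m => x k := fun k => PiLp.continuous_apply 2 _ k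
    simp only [hw, layerDeformation_apply]
    exact (continuous_finsetSum _ fun k _ =>
      ((h0.continuous_rot i k).comp continuous_height).mul (hx k)).add
        ((h0.continuous_shift i).comp continuous_height)
  have hwi : ∀ i, IntegrableOn (fun x => u x i - w x i) Ω volume := by
    intro i
    refine Integrable.sub (memLp_one_iff_integrable.1 ((hu i).1.mono_exponent hp1)) ?_
    exact ((hwc i).locallyIntegrable.integrableOn_isCompact
      hΩ.isBounded.isCompact_closure).mono_set subset_closure
  choose e he using fun i => exists_ae_eq_const_of_hasWeakPartial_zero hΩ.isOpen hΩ.isConnected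
    (hwi i) (hdiff i)
  refine ⟨P, T, _, Δ, hprof e, (hprof e).rot_mem hab (fun t ht => ?_) ?_, hRP, hSS, hdd, ?_⟩
  · ext i j
    exact hσ0 i j t ht
  · filter_upwards [hRSO, hRP] with x h1 h2
    rwa [← h2]
  · filter_upwards [ae_all_iff.2 he] with x hx
    ext i
    have := hx i
    simp only [hw, layerDeformation_apply] at this ⊢
    linarith

/-! ### Soft and stiff layers, and `L^p` estimates -/

theorem mem_softLayers_iff {m : ℕ} {lam ε : ℝ} (hε : 0 < ε) {x : Space m} :
    x ∈ softLayers m lam ε ↔ height x ∈ softHeights lam ε := by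
  constructor
  · rintro ⟨y, ⟨k, -, hk⟩, rfl⟩
    refine ⟨k (Fin.last m), ?_⟩
    have : height (ε • y) / ε = y (Fin.last m) := by
      simp only [height, PiLp.smul_apply, smul_eq_mul]
      field_simp
    rw [this]
    exact hk
  · rintro ⟨k, hk⟩
    refine ⟨ε⁻¹ • x, ⟨Fin.lastCases k fun i => ⌈(ε⁻¹ • x) i.castSucc⌉ - 1, fun i => ?_, ?_⟩, ?_⟩
    · simp only [Fin.lastCases_castSucc, Int.cast_sub, Int.cast_one]
      constructor
      · linarith [Int.ceil_lt_add_one ((ε⁻¹ • x) i.castSucc)]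
      · linarith [Int.le_ceil ((ε⁻¹ • x) i.castSucc)]
    · simp only [Fin.lastCases_last]
      have : (ε⁻¹ • x) (Fin.last m) = height x / ε := by
        simp only [height, PiLp.smul_apply, smul_eq_mul]
        field_simp
      rwa [this]
    · exact smul_inv_smul₀ hε.ne' x

theorem softLayers_eq_preimage {m : ℕ} {lam ε : ℝ} (hε : 0 < ε) :
    softLayers m lam ε = height ⁻¹' softHeights lam ε :=
  Set.ext fun _ => mem_softLayers_iff hε

theorem height_notMem_softHeights {m : ℕ} {lam ε : ℝ} (hε : 0 < ε) {x : Space m}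
    (hx : x ∈ stiffLayers m lam ε) : height x ∉ softHeights lam ε := by
  obtain ⟨y, ⟨k, hk, hks⟩, rfl⟩ := hx
  have hy : height (ε • y) / ε = y (Fin.last m) := by
    simp only [height, PiLp.smul_apply, smul_eq_mul]
    field_simp
  rintro ⟨l, hl⟩
  rw [hy] at hl
  have h1 := hk (Fin.last m)
  have h2 : ¬ (y (Fin.last m) - k (Fin.last m) ∈ Ioo 0 lam) := fun h =>
    hks ⟨fun i => hk i.castSucc, h⟩
  have h1' : y (Fin.last m) - k (Fin.last m) ∈ Ioc (0 : ℝ) 1 := h1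
  have h3 : lam ≤ y (Fin.last m) - k (Fin.last m) := by
    by_contra h
    exact h2 ⟨h1'.1, not_le.1 h⟩
  have h4 : (k (Fin.last m) : ℝ) < l := by linarith [hl.2]
  have h5 : (l : ℝ) < k (Fin.last m) + 1 := by linarith [hl.1, h1'.2]
  have h4' : k (Fin.last m) < l := by exact_mod_cast h4
  have h5' : l < k (Fin.last m) + 1 := by exact_mod_cast h5
  lia

/-- The `L^p` norm of `x ↦ A x + B` on a set on which the coordinates are bounded by `ρ`. -/
theorem eLpNorm_sum_mul_add_le {m : ℕ} {μ : Measure (Space m)} {ρ : ℝ}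
    (hρ : ∀ᵐ x ∂μ, ∀ k, |x k| ≤ ρ) {p : ℝ≥0∞} (hp : 1 ≤ p) {A : Fin (m + 1) → Space m → ℝ}
    {B : Space m → ℝ} (hA : ∀ k, AEStronglyMeasurable (A k) μ) (hB : AEStronglyMeasurable B μ) :
    eLpNorm (fun x => ∑ k, A k x * x k + B x) p μ
      ≤ ∑ k, ENNReal.ofReal ρ * eLpNorm (A k) p μ + eLpNorm B p μ := by
  have hx : ∀ k, Continuous fun x : Space m => x k := fun k => PiLp.continuous_apply 2 _ k
  have hAx : ∀ k, AEStronglyMeasurable (fun x => A k x * x k) μ := fun k =>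
    (hA k).mul (hx k).aestronglyMeasurable
  have e : (fun x => ∑ k, A k x * x k + B x) = (∑ k, fun x : Space m => A k x * x k) + B := by
    ext x
    simp [Finset.sum_apply]
  rw [e]
  refine (eLpNorm_add_le (Finset.aestronglyMeasurable_sum _ fun k _ => hAx k) hB hp).trans ?_
  gcongr
  refine (eLpNorm_sum_le (fun k _ => hAx k) hp).trans (Finset.sum_le_sum fun k _ => ?_)
  refine eLpNorm_le_mul_eLpNorm_of_ae_le_mul ?_ p
  filter_upwards [hρ] with x hx
  rw [norm_mul, mul_comm]
  exact mul_le_mul_of_nonneg_right (hx k) (norm_nonneg _)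

theorem frobNorm_le_sum_abs {m : ℕ} (A : Mat m) : frobNorm A ≤ ∑ i, ∑ j, |A i j| := by
  have h0 : ∀ i, 0 ≤ ∑ j, |A i j| := fun i => Finset.sum_nonneg fun j _ => abs_nonneg _
  rw [frobNorm, Real.sqrt_le_left (Finset.sum_nonneg fun i _ => h0 i)]
  refine le_trans (Finset.sum_le_sum fun i _ => ?_)
    (Finset.sum_sq_le_sq_sum_of_nonneg fun i _ => h0 i)
  simp only [← sq_abs (A i _)]
  exact Finset.sum_sq_le_sq_sum_of_nonneg fun j _ => abs_nonneg _

theorem memLp_of_continuous_of_isBounded {m : ℕ} {Ω : Set (Space m)} (hΩ : Bornology.IsBounded Ω)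
    {f : Space m → ℝ} (hf : Continuous f) (p : ℝ≥0∞) : MemLp f p (volume.restrict Ω) := by
  have hfin : IsFiniteMeasure (volume.restrict (closure Ω)) :=
    ⟨by rw [Measure.restrict_apply_univ]; exact hΩ.isCompact_closure.measure_lt_top⟩
  obtain ⟨C, hC⟩ := hΩ.isCompact_closure.exists_bound_of_continuousOn hf.continuousOn
  have : MemLp f p (volume.restrict (closure Ω)) :=
    MemLp.of_bound hf.aestronglyMeasurable C
      (ae_restrict_of_forall_mem isClosed_closure.measurableSet hC)
  exact this.mono_measure (Measure.restrict_mono subset_closure le_rfl)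

theorem memLp_sum_mul_add {m : ℕ} {Ω : Set (Space m)} (hΩ : Bornology.IsBounded Ω)
    (hm : MeasurableSet Ω) {p : ℝ≥0∞} {A : Fin (m + 1) → Space m → ℝ} {B : Space m → ℝ}
    (hA : ∀ k, MemLp (A k) p (volume.restrict Ω)) (hB : MemLp B p (volume.restrict Ω)) :
    MemLp (fun x => ∑ k, A k x * x k + B x) p (volume.restrict Ω) := by
  obtain ⟨ρ, hρ⟩ := hΩ.subset_closedBall (0 : Space m)
  refine MemLp.add (memLp_finsetSum _ fun k _ => ?_) hB
  have hx : Continuous fun x : Space m => x k := PiLp.continuous_apply 2 _ k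
  refine MemLp.of_le_mul (c := ρ) (hA k) ((hA k).1.mul hx.aestronglyMeasurable) ?_
  filter_upwards [ae_restrict_mem hm] with x hxΩ
  have := hρ hxΩ
  rw [mem_closedBall_zero_iff] at this
  rw [norm_mul, mul_comm]
  exact mul_le_mul_of_nonneg_right ((PiLp.norm_apply_le x k).trans this) (norm_nonneg _)

/-- Composition of a continuous function of the height with layer maps close to the identity is
uniformly, hence `L^p`, close to the function itself. -/
theorem tendsto_eLpNorm_continuous_comp_layerMap_sub {m : ℕ} {Ω : Set (Space m)}
    (hΩ : Bornology.IsBounded Ω) (hm : MeasurableSet Ω) {F : ℝ → ℝ} (hF : Continuous F)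
    {θ : ℝ → ℝ → ℝ} (hθ : ∀ ε > 0, ∀ t, |θ ε t - t| ≤ ε) {p : ℝ≥0∞} :
    Tendsto (fun ε => eLpNorm (fun x => F (θ ε (height x)) - F (height x)) p (volume.restrict Ω))
      (𝓝[>] 0) (𝓝 0) := by
  have hfin : volume Ω ≠ ⊤ := hΩ.measure_lt_top.ne
  obtain ⟨ρ, hρ⟩ := hΩ.subset_closedBall (0 : Space m)
  have huc := (isCompact_Icc (a := -ρ - 1) (b := ρ + 1)).uniformContinuousOn_of_continuous
    hF.continuousOn
  rw [Metric.uniformContinuousOn_iff] at huc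
  rw [ENNReal.tendsto_nhds_zero]
  intro η hη
  set K := (volume.restrict Ω) univ ^ p.toReal⁻¹ with hK
  have hKtop : K ≠ ⊤ := by
    refine ENNReal.rpow_ne_top_of_nonneg (by positivity) ?_
    rwa [Measure.restrict_apply_univ]
  obtain ⟨c, hc0, hc⟩ : ∃ c : ℝ, 0 < c ∧ K * ENNReal.ofReal c ≤ η := by
    have : Tendsto (fun c : ℝ => K * ENNReal.ofReal c) (𝓝[>] 0) (𝓝 0) := by
      have h0 : Tendsto (fun c : ℝ => ENNReal.ofReal c) (𝓝[>] 0) (𝓝 0) := by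
        have := (ENNReal.continuous_ofReal.tendsto (0 : ℝ)).mono_left
          (nhdsWithin_le_nhds (s := Ioi (0 : ℝ)))
        simpa using this
      simpa using ENNReal.Tendsto.const_mul h0 (Or.inr hKtop)
    obtain ⟨c, h1, h2⟩ := ((ENNReal.tendsto_nhds_zero.1 this η hη).and self_mem_nhdsWithin).exists
    exact ⟨c, h2, h1⟩
  obtain ⟨r, hr, hrc⟩ := huc c hc0
  filter_upwards [Ioo_mem_nhdsGT (lt_min hr one_pos)] with ε hε
  have hεr : ε < r := hε.2.trans_le (min_le_left _ _)
  have hε1 : ε < 1 := hε.2.trans_le (min_le_right _ _)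
  refine (eLpNorm_le_of_ae_bound (C := c) ?_).trans hc
  filter_upwards [ae_restrict_mem hm] with x hx
  have h1 := hρ hx
  rw [mem_closedBall_zero_iff] at h1
  have h2 : |height x| ≤ ρ := (PiLp.norm_apply_le x (Fin.last m)).trans h1
  have h3 := abs_le.1 h2
  have h4 := hθ ε hε.1 (height x)
  have h5 := abs_le.1 h4
  rw [← dist_eq_norm]
  refine (hrc _ ⟨?_, ?_⟩ _ ⟨?_, ?_⟩ ?_).le
  · linarith
  · linarith
  · linarith
  · linarith
  · rw [Real.dist_eq]; linarith

theorem map_height_restrict_preimage_le {m : ℕ} {Ω : Set (Space m)} {C : ℝ≥0∞}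
    (hle : (volume.restrict Ω).map height ≤ C • volume) {A : Set ℝ} (hA : MeasurableSet A) :
    (volume.restrict (height ⁻¹' A ∩ Ω)).map height ≤ C • volume.restrict A := by
  have h1 : (volume.restrict (height ⁻¹' A ∩ Ω)).map height
      = ((volume.restrict Ω).map height).restrict A := by
    rw [Measure.restrict_map measurable_height hA, Measure.restrict_restrict (measurable_height hA)]
  rw [h1, ← Measure.restrict_smul]
  exact Measure.restrict_mono subset_rfl hle

theorem aestronglyMeasurable_comp_height {m : ℕ} {μ : Measure (Space m)} {ν : Measure ℝ} {C : ℝ≥0∞}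
    (hle : μ.map height ≤ C • ν) {f : ℝ → ℝ} (hf : AEStronglyMeasurable f ν) :
    AEStronglyMeasurable (fun x => f (height x)) μ :=
  (hf.mono_ac (Measure.absolutelyContinuous_of_le_smul hle)).comp_measurable measurable_height

theorem eLpNorm_comp_height_le {m : ℕ} {μ : Measure (Space m)} {ν : Measure ℝ} {C : ℝ≥0∞}
    (hle : μ.map height ≤ C • ν) {p : ℝ≥0∞} (hp : p ≠ ⊤) {f : ℝ → ℝ}
    (hf : AEStronglyMeasurable f ν) :
    eLpNorm (fun x => f (height x)) p μ ≤ C ^ (1 / p).toReal * eLpNorm f p ν := by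
  have h2 := eLpNorm_map_measure (p := p)
    (hf.mono_ac (Measure.absolutelyContinuous_of_le_smul hle)) measurable_height.aemeasurable
  rw [Function.comp_def] at h2
  rw [← h2]
  refine (eLpNorm_mono_measure _ hle).trans ?_
  rw [eLpNorm_smul_measure_of_ne_top hp, smul_eq_mul]

namespace IsProfile

variable {m : ℕ} {p : ℝ≥0∞} {R σ : ℝ → Mat m} {D δ : ℝ → Space m} {Ω : Set (Space m)}

theorem memLp_rot_height (h : IsProfile p R σ D δ) (hΩ : Bornology.IsBounded Ω)
    (i j : Fin (m + 1)) : MemLp (fun x => R (height x) i j) p (volume.restrict Ω) :=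
  memLp_of_continuous_of_isBounded hΩ ((h.continuous_rot i j).comp continuous_height) p

theorem memLp_layerDeformation (h : IsProfile p R σ D δ) (hΩ : Bornology.IsBounded Ω)
    (hm : MeasurableSet Ω) (i : Fin (m + 1)) :
    MemLp (fun x => layerDeformation R D x i) p (volume.restrict Ω) :=
  memLp_sum_mul_add hΩ hm (fun k => h.memLp_rot_height hΩ i k)
    (memLp_of_continuous_of_isBounded hΩ ((h.continuous_shift i).comp continuous_height) p)

theorem memLp_layeredField (h : IsProfile p R σ D δ) (hΩ : Bornology.IsBounded Ω)
    (hm : MeasurableSet Ω) (c : ℝ) (i j : Fin (m + 1)) :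
    MemLp (fun x => layeredField c (fun x => R (height x)) (fun x => σ (height x))
      (fun x => δ (height x)) x i j) p (volume.restrict Ω) := by
  simp only [layeredField_apply]
  refine (h.memLp_rot_height hΩ i j).add ?_
  split_ifs
  · exact (memLp_sum_mul_add hΩ hm (fun k => memLp_comp_height hΩ (h.memLp_rot i k))
      (memLp_comp_height hΩ (h.memLp_shift i))).const_mul c
  · exact MemLp.zero'

theorem memW1p_layerDeformation (h : IsProfile p R σ D δ) (hΩ : Bornology.IsBounded Ω)
    (hm : MeasurableSet Ω) (i : Fin (m + 1)) :
    MemW1p Ω p (fun x => layerDeformation R D x i) :=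
  ⟨h.memLp_layerDeformation hΩ hm i, fun j => ⟨_, h.hasWeakGradient Ω i j,
    h.memLp_layeredField hΩ hm 1 i j⟩⟩

theorem memLp_ite_rot_height (h : IsProfile p R σ D δ) (hΩ : Bornology.IsBounded Ω)
    (i k j : Fin (m + 1)) : MemLp (fun x => if j = Fin.last m then σ (height x) i k else 0) p
      (volume.restrict Ω) := by
  split_ifs
  · exact memLp_comp_height hΩ (h.memLp_rot i k)
  · exact MemLp.zero'

theorem memW1p_rot (h : IsProfile p R σ D δ) (hΩ : Bornology.IsBounded Ω) (i k : Fin (m + 1)) :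
    MemW1p Ω p (fun x => R (height x) i k) :=
  ⟨h.memLp_rot_height hΩ i k, fun j => ⟨_, h.hasWeakPartial_rot Ω i k j,
    h.memLp_ite_rot_height hΩ i k j⟩⟩

end IsProfile

/-! ### Convergence of the reparametrised deformations -/

theorem IsLayerMap.eLpNorm_indicator_comp_height_le {Λ ε : ℝ} {A : Set ℝ} {θ : ℝ → ℝ}
    (hθ : IsLayerMap Λ ε A θ) (hΛ : 1 ≤ Λ) {m : ℕ} {μ : Measure (Space m)} {C : ℝ≥0∞}
    (hle : μ.map height ≤ C • volume) {p : ℝ≥0∞} (hp : p ≠ ⊤) {f : ℝ → ℝ} (hf : MemLp f p volume) :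
    AEStronglyMeasurable (fun x : Space m => A.indicator (fun t => Λ * f (θ t)) (height x)) μ ∧
      eLpNorm (fun x : Space m => A.indicator (fun t => Λ * f (θ t)) (height x)) p μ
        ≤ C ^ (1 / p).toReal * (ENNReal.ofReal Λ * eLpNorm f p volume) := by
  have hfm := (hθ.memLp_indicator_comp hΛ hf).1
  refine ⟨aestronglyMeasurable_comp_height hle hfm, (eLpNorm_comp_height_le hle hp hfm).trans ?_⟩
  gcongr
  exact hθ.eLpNorm_indicator_comp_le hΛ hf.1 p

theorem eLpNorm_frobNorm_le {m : ℕ} {μ : Measure (Space m)} {p : ℝ≥0∞} (hp : 1 ≤ p)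
    {M : Space m → Mat m} (hM : ∀ i j, AEStronglyMeasurable (fun x => M x i j) μ) :
    eLpNorm (fun x => frobNorm (M x)) p μ ≤ ∑ i, ∑ j, eLpNorm (fun x => M x i j) p μ := by
  set f : Fin (m + 1) → Fin (m + 1) → Space m → ℝ := fun i j x => |M x i j| with hf
  have hfm : ∀ i j, AEStronglyMeasurable (f i j) μ := fun i j => (hM i j).norm
  calc eLpNorm (fun x => frobNorm (M x)) p μ ≤ eLpNorm (∑ i, ∑ j, f i j) p μ := by
        refine eLpNorm_mono_real fun x => ?_
        have h0 : 0 ≤ frobNorm (M x) := Real.sqrt_nonneg _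
        rw [Real.norm_of_nonneg h0, Finset.sum_apply]
        simp only [Finset.sum_apply, hf]
        exact frobNorm_le_sum_abs (M x)
    _ ≤ ∑ i, eLpNorm (∑ j, f i j) p μ :=
        eLpNorm_sum_le (fun i _ => Finset.aestronglyMeasurable_sum _ fun j _ => hfm i j) hp
    _ ≤ ∑ i, ∑ j, eLpNorm (f i j) p μ :=
        Finset.sum_le_sum fun i _ => eLpNorm_sum_le (fun j _ => hfm i j) hp
    _ = ∑ i, ∑ j, eLpNorm (fun x => M x i j) p μ :=
        Finset.sum_congr rfl fun i _ => Finset.sum_congr rfl fun j _ =>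
          eLpNorm_norm (fun x => M x i j)

section Convergence

variable {m : ℕ} {p : ℝ≥0∞} {R σ : ℝ → Mat m} {D δ : ℝ → Space m} {Ω : Set (Space m)}

/-- The layer deformations with reparametrised profiles converge strongly in `L^p`. -/
theorem IsProfile.tendsto_eLpNorm_layerDeformation_comp_sub (h : IsProfile p R σ D δ) (hp : 1 ≤ p)
    (hΩ : Bornology.IsBounded Ω) (hm : MeasurableSet Ω) {θ : ℝ → ℝ → ℝ}
    (hθ : ∀ ε > 0, ∀ t, |θ ε t - t| ≤ ε) (hθc : ∀ ε > 0, Continuous (θ ε)) (i : Fin (m + 1)) :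
    Tendsto (fun ε => eLpNorm (fun x => layerDeformation (R ∘ θ ε) (D ∘ θ ε) x i
      - layerDeformation R D x i) p (volume.restrict Ω)) (𝓝[>] 0) (𝓝 0) := by
  obtain ⟨ρ, hρ⟩ := hΩ.subset_closedBall (0 : Space m)
  have hρ' : ∀ᵐ x ∂(volume.restrict Ω), ∀ k, |x k| ≤ ρ := by
    filter_upwards [ae_restrict_mem hm] with x hx k
    exact (PiLp.norm_apply_le x k).trans (mem_closedBall_zero_iff.1 (hρ hx))
  have hlim : Tendsto (fun ε => ∑ k, ENNReal.ofReal ρ * eLpNorm (fun x : Space m =>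
      R (θ ε (height x)) i k - R (height x) i k) p (volume.restrict Ω)
      + eLpNorm (fun x : Space m => D (θ ε (height x)) i - D (height x) i) p (volume.restrict Ω))
      (𝓝[>] 0) (𝓝 0) := by
    have h1 : ∀ k ∈ (Finset.univ : Finset (Fin (m + 1))), Tendsto (fun ε => ENNReal.ofReal ρ
        * eLpNorm (fun x : Space m => R (θ ε (height x)) i k - R (height x) i k) p
          (volume.restrict Ω)) (𝓝[>] 0) (𝓝 0) := fun k _ => by
      simpa using ENNReal.Tendsto.const_mul (a := ENNReal.ofReal ρ)
        (tendsto_eLpNorm_continuous_comp_layerMap_sub hΩ hm (h.continuous_rot i k) hθ (p := p))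
        (Or.inr ENNReal.ofReal_ne_top)
    simpa using (tendsto_finsetSum _ h1).add
      (tendsto_eLpNorm_continuous_comp_layerMap_sub hΩ hm (h.continuous_shift i) hθ (p := p))
  refine tendsto_of_tendsto_of_tendsto_of_le_of_le' tendsto_const_nhds hlim
    (Eventually.of_forall fun _ => zero_le) ?_
  filter_upwards [self_mem_nhdsWithin] with ε hε
  have hc := hθc ε hε
  have e : (fun x => layerDeformation (R ∘ θ ε) (D ∘ θ ε) x i - layerDeformation R D x i)
      = fun x => ∑ k, (R (θ ε (height x)) i k - R (height x) i k) * x k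
        + (D (θ ε (height x)) i - D (height x) i) := by
    ext x
    simp only [layerDeformation_apply, Function.comp_apply, sub_mul, Finset.sum_sub_distrib]
    ring
  rw [e]
  have hcc : ∀ {F : ℝ → ℝ}, Continuous F →
      Continuous fun x : Space m => F (θ ε (height x)) - F (height x) := fun hF =>
    (hF.comp (hc.comp continuous_height)).sub (hF.comp continuous_height)
  exact eLpNorm_sum_mul_add_le hρ' hp (fun k => (hcc (h.continuous_rot i k)).aestronglyMeasurable)
    (hcc (h.continuous_shift i)).aestronglyMeasurable

/-- The gradients of the reparametrised layer deformations are bounded in `L^p`. -/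
theorem IsProfile.exists_eLpNorm_layeredField_comp_le (h : IsProfile p R σ D δ) (hp : 1 ≤ p)
    (hp2 : p ≠ ⊤) (hSO : ∀ t, R t ∈ Matrix.specialOrthogonalGroup (Fin (m + 1)) ℝ)
    (hΩ : Bornology.IsBounded Ω) (hm : MeasurableSet Ω) {Λ : ℝ} (hΛ : 1 ≤ Λ) (i j : Fin (m + 1)) :
    ∃ M : ℝ≥0∞, M ≠ ⊤ ∧ ∀ {ε : ℝ} {A : Set ℝ} {θ : ℝ → ℝ}, IsLayerMap Λ ε A θ →
      eLpNorm (fun x => layeredField 1 (fun x => R (θ (height x)))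
        (fun x => layerDeriv Λ A θ σ (height x)) (fun x => layerDeriv Λ A θ δ (height x)) x i j) p
        (volume.restrict Ω) ≤ M := by
  obtain ⟨ρ, hρ⟩ := hΩ.subset_closedBall (0 : Space m)
  have hρ' : ∀ᵐ x ∂(volume.restrict Ω), ∀ k, |x k| ≤ ρ := by
    filter_upwards [ae_restrict_mem hm] with x hx k
    exact (PiLp.norm_apply_le x k).trans (mem_closedBall_zero_iff.1 (hρ hx))
  obtain ⟨C, hC, hle⟩ := exists_map_height_le hΩ
  have hCtop : C ^ (1 / p).toReal ≠ ⊤ := ENNReal.rpow_ne_top_of_nonneg ENNReal.toReal_nonneg hC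
  set K := (volume.restrict Ω) univ ^ p.toReal⁻¹ * ENNReal.ofReal 1 with hK
  have hKtop : K ≠ ⊤ := by
    refine ENNReal.mul_ne_top (ENNReal.rpow_ne_top_of_nonneg (by positivity) ?_)
      ENNReal.ofReal_ne_top
    rw [Measure.restrict_apply_univ]
    exact hΩ.measure_lt_top.ne
  set N : (ℝ → ℝ) → ℝ≥0∞ := fun f =>
    C ^ (1 / p).toReal * (ENNReal.ofReal Λ * eLpNorm f p volume) with hN
  have hNtop : ∀ {f : ℝ → ℝ}, MemLp f p volume → N f ≠ ⊤ := fun hf =>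
    ENNReal.mul_ne_top hCtop (ENNReal.mul_ne_top ENNReal.ofReal_ne_top hf.eLpNorm_ne_top)
  refine ⟨K + (∑ k, ENNReal.ofReal ρ * N (fun t => σ t i k) + N (fun t => δ t i)),
    ENNReal.add_ne_top.2 ⟨hKtop, ENNReal.add_ne_top.2 ⟨ENNReal.sum_ne_top.2 fun k _ =>
      ENNReal.mul_ne_top ENNReal.ofReal_ne_top (hNtop (h.memLp_rot i k)),
      hNtop (h.memLp_shift i)⟩⟩, ?_⟩
  intro ε A θ hθ
  have hprof := h.comp hΛ hθ
  have hNle : ∀ {f : ℝ → ℝ}, MemLp f p volume →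
      AEStronglyMeasurable (fun x : Space m => A.indicator (fun t => Λ * f (θ t)) (height x))
        (volume.restrict Ω) ∧
      eLpNorm (fun x : Space m => A.indicator (fun t => Λ * f (θ t)) (height x)) p
        (volume.restrict Ω) ≤ N f := fun hf => hθ.eLpNorm_indicator_comp_height_le hΛ hle hp2 hf
  have hRK : eLpNorm (fun x : Space m => R (θ (height x)) i j) p (volume.restrict Ω) ≤ K := by
    refine eLpNorm_le_of_ae_bound (Eventually.of_forall fun x => ?_)
    exact entry_norm_bound_of_unitary
      (Matrix.mem_specialOrthogonalGroup_iff.1 (hSO (θ (height x)))).1 i j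
  have hRm : AEStronglyMeasurable (fun x : Space m => R (θ (height x)) i j) (volume.restrict Ω) :=
    (hprof.memLp_rot_height hΩ i j).1
  simp only [layeredField_apply]
  by_cases hj : j = Fin.last m
  · simp only [hj, if_true, one_mul, layerDeriv_matrix_apply, layerDeriv_vector_apply] at hRm hRK ⊢
    have hA := fun k => hNle (h.memLp_rot i k)
    have hB := hNle (h.memLp_shift i)
    have hx : ∀ k, Continuous fun x : Space m => x k := fun k => PiLp.continuous_apply 2 _ k
    have hsum := eLpNorm_sum_mul_add_le hρ' hp (fun k => (hA k).1) hB.1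
    refine (eLpNorm_add_le hRm ?_ hp).trans (add_le_add hRK (hsum.trans ?_))
    · exact (Finset.aestronglyMeasurable_fun_sum _ fun k _ =>
        (hA k).1.mul (hx k).aestronglyMeasurable).add hB.1
    · exact add_le_add (Finset.sum_le_sum fun k _ => by gcongr; exact (hA k).2) hB.2
  · simp only [hj, if_false, add_zero]
    exact hRK.trans le_self_add

/-- On the moving layers the gradients of the reparametrised layer deformations approach the limit
field, in which the transversal part is amplified by the factor `Λ`. -/
theorem IsProfile.tendsto_eLpNorm_layeredField_comp_sub (h : IsProfile p R σ D δ) (hp : 1 ≤ p)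
    (hp2 : p ≠ ⊤) (hΩ : Bornology.IsBounded Ω) (hm : MeasurableSet Ω) {Λ : ℝ} (hΛ : 1 ≤ Λ)
    {A : ℝ → Set ℝ} {θ : ℝ → ℝ → ℝ} (hθ : ∀ ε > 0, IsLayerMap Λ ε (A ε) (θ ε))
    (i j : Fin (m + 1)) :
    Tendsto (fun ε => eLpNorm (fun x => layeredField 1 (fun x => R (θ ε (height x)))
        (fun x => layerDeriv Λ (A ε) (θ ε) σ (height x))
        (fun x => layerDeriv Λ (A ε) (θ ε) δ (height x)) x i j
        - layeredField Λ (fun x => R (height x)) (fun x => σ (height x))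
          (fun x => δ (height x)) x i j) p
      (volume.restrict (height ⁻¹' A ε ∩ Ω))) (𝓝[>] 0) (𝓝 0) := by
  obtain ⟨ρ, hρ⟩ := hΩ.subset_closedBall (0 : Space m)
  obtain ⟨C, hC, hle⟩ := exists_map_height_le hΩ
  have hCtop : C ^ (1 / p).toReal ≠ ⊤ := ENNReal.rpow_ne_top_of_nonneg ENNReal.toReal_nonneg hC
  set N : ℝ → (ℝ → ℝ) → ℝ≥0∞ := fun ε f =>
    C ^ (1 / p).toReal * eLpNorm (f ∘ θ ε - f) p (volume.restrict (A ε)) with hN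
  have hNlim : ∀ {f : ℝ → ℝ}, MemLp f p volume →
      Tendsto (fun ε => N ε f) (𝓝[>] 0) (𝓝 0) := fun hf => by
    have h1 := ENNReal.Tendsto.const_mul (a := C ^ (1 / p).toReal)
      (tendsto_eLpNorm_comp_layerMap_sub hΛ hθ hp hp2 hf) (Or.inr hCtop)
    rwa [mul_zero] at h1
  have hlim : Tendsto (fun ε => eLpNorm (fun x : Space m =>
      R (θ ε (height x)) i j - R (height x) i j) p (volume.restrict Ω)
      + ‖Λ‖ₑ * (∑ k, ENNReal.ofReal ρ * N ε (fun t => σ t i k) + N ε (fun t => δ t i)))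
      (𝓝[>] 0) (𝓝 0) := by
    have h1 : ∀ k ∈ (Finset.univ : Finset (Fin (m + 1))), Tendsto (fun ε => ENNReal.ofReal ρ
        * N ε (fun t => σ t i k)) (𝓝[>] 0) (𝓝 0) := fun k _ => by
      simpa using ENNReal.Tendsto.const_mul (a := ENNReal.ofReal ρ) (hNlim (h.memLp_rot i k))
        (Or.inr ENNReal.ofReal_ne_top)
    have h2 := (tendsto_finsetSum _ h1).add (hNlim (h.memLp_shift i))
    have h3 := ENNReal.Tendsto.const_mul (a := ‖Λ‖ₑ) h2 (Or.inr enorm_ne_top)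
    have h4 := tendsto_eLpNorm_continuous_comp_layerMap_sub hΩ hm (h.continuous_rot i j)
      (fun ε hε => (hθ ε hε).abs_sub_le) (p := p)
    simpa using h4.add h3
  refine tendsto_of_tendsto_of_tendsto_of_le_of_le' tendsto_const_nhds hlim
    (Eventually.of_forall fun _ => zero_le) ?_
  filter_upwards [self_mem_nhdsWithin] with ε hε
  have hθε := hθ ε hε
  set μ := volume.restrict (height ⁻¹' A ε ∩ Ω) with hμ
  have hsm : MeasurableSet (height ⁻¹' A ε ∩ Ω : Set (Space m)) :=
    (measurable_height hθε.measurableSet).inter hm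
  have hρ' : ∀ᵐ x ∂μ, ∀ k, |x k| ≤ ρ := by
    filter_upwards [ae_restrict_mem hsm] with x hx k
    exact (PiLp.norm_apply_le x k).trans (mem_closedBall_zero_iff.1 (hρ hx.2))
  have hleA := map_height_restrict_preimage_le hle hθε.measurableSet
  have hNle : ∀ {f : ℝ → ℝ}, MemLp f p volume →
      AEStronglyMeasurable (fun x : Space m => f (θ ε (height x)) - f (height x)) μ ∧
      eLpNorm (fun x : Space m => f (θ ε (height x)) - f (height x)) p μ ≤ N ε f := by
    intro f hf
    have hfm : AEStronglyMeasurable (f ∘ θ ε - f) (volume.restrict (A ε)) :=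
      (hf.1.comp_quasiMeasurePreserving hθε.quasiMeasurePreserving).sub hf.1.restrict
    exact ⟨aestronglyMeasurable_comp_height (f := f ∘ θ ε - f) hleA hfm,
      eLpNorm_comp_height_le (f := f ∘ θ ε - f) hleA hp2 hfm⟩
  set B : Space m → ℝ := fun x => ∑ k, (σ (θ ε (height x)) i k - σ (height x) i k) * x k
    + (δ (θ ε (height x)) i - δ (height x) i) with hB
  have hA1 := fun k => hNle (h.memLp_rot i k)
  have hA2 := hNle (h.memLp_shift i)
  have hx : ∀ k, Continuous fun x : Space m => x k := fun k => PiLp.continuous_apply 2 _ k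
  have hBm : AEStronglyMeasurable B μ := (Finset.aestronglyMeasurable_fun_sum _ fun k _ =>
    (hA1 k).1.mul (hx k).aestronglyMeasurable).add hA2.1
  have hBle : eLpNorm B p μ ≤ ∑ k, ENNReal.ofReal ρ * N ε (fun t => σ t i k)
      + N ε (fun t => δ t i) :=
    (eLpNorm_sum_mul_add_le hρ' hp (fun k => (hA1 k).1) hA2.1).trans
      (add_le_add (Finset.sum_le_sum fun k _ => by gcongr; exact (hA1 k).2) hA2.2)
  have hRm : Continuous fun x : Space m => R (θ ε (height x)) i j - R (height x) i j :=
    ((h.continuous_rot i j).comp (hθε.continuous.comp continuous_height)).sub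
      ((h.continuous_rot i j).comp continuous_height)
  have hRle : eLpNorm (fun x : Space m => R (θ ε (height x)) i j - R (height x) i j) p μ
      ≤ eLpNorm (fun x : Space m => R (θ ε (height x)) i j - R (height x) i j) p
        (volume.restrict Ω) :=
    eLpNorm_mono_measure _ (Measure.restrict_mono inter_subset_right le_rfl)
  have hdiff : (fun x => layeredField 1 (fun x => R (θ ε (height x)))
        (fun x => layerDeriv Λ (A ε) (θ ε) σ (height x))
        (fun x => layerDeriv Λ (A ε) (θ ε) δ (height x)) x i j
        - layeredField Λ (fun x => R (height x)) (fun x => σ (height x))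
          (fun x => δ (height x)) x i j)
      =ᵐ[μ] fun x => (R (θ ε (height x)) i j - R (height x) i j)
        + if j = Fin.last m then Λ * B x else 0 := by
    filter_upwards [ae_restrict_mem hsm] with x hx
    have hxA : height x ∈ A ε := hx.1
    simp only [layeredField_apply, layerDeriv_matrix_apply, layerDeriv_vector_apply,
      indicator_of_mem hxA, hB]
    split_ifs
    · simp only [mul_assoc, ← Finset.mul_sum, sub_mul, Finset.sum_sub_distrib]
      ring
    · ring
  rw [eLpNorm_congr_ae hdiff]
  by_cases hj : j = Fin.last m
  · simp only [hj, if_true] at hRm hRle ⊢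
    refine (eLpNorm_add_le hRm.aestronglyMeasurable (hBm.const_mul Λ) hp).trans ?_
    refine add_le_add hRle ?_
    refine (eLpNorm_const_smul Λ B p μ).le.trans ?_
    gcongr
  · simp only [hj, if_false, add_zero]
    exact hRle.trans le_self_add

end Convergence

theorem proposition4 (m : ℕ) (hm : 1 ≤ m) (lam : ℝ) (hlam0 : 0 < lam) (hlam1 : lam < 1)
    (p : ℝ≥0∞) (hp1 : 1 < p) (hp2 : p < ⊤)
    (Ω : Set (Space m)) (hΩ : IsBoundedLipschitzDomain Ω) (hflat : IsFlat Ω)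
    (hcross : IsCrossSectionConnected Ω)
    (u : Space m → Space m) (R S : Space m → Mat m) (d : Space m → Space m)
    -- `u ∈ W^{1,p}(Ω; ℝⁿ)`
    (hu : ∀ i, MemW1p Ω p (fun x => u x i))
    -- `R ∈ W^{1,p}(Ω; SO(n))` with `∇'R = 0` and `∂_n R = S`
    (hR : ∀ i j, MemW1p Ω p (fun x => R x i j))
    (hRSO : ∀ᵐ x ∂(volume.restrict Ω), R x ∈ Matrix.specialOrthogonalGroup (Fin (m + 1)) ℝ)
    (hR' : ∀ i j, ∀ k : Fin m, HasWeakPartial Ω k.castSucc (fun x => R x i j) (fun _ => 0))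
    (hRn : ∀ i j, HasWeakPartial Ω (Fin.last m) (fun x => R x i j) (fun x => S x i j))
    -- `d ∈ L^p(Ω; ℝⁿ)` with `D'd = 0`
    (hd : MemLp d p (volume.restrict Ω))
    (hd' : ∀ i, ∀ k : Fin m, HasWeakPartial Ω k.castSucc (fun x => d x i) (fun _ => 0))
    -- `∇u = R + (∂_n R) x ⊗ e_n + d ⊗ e_n`
    (hgrad : HasWeakGradient Ω u (layeredField 1 R S d)) :
    ∃ (uε : ℝ → Space m → Space m) (Gε Rε Sε : ℝ → Space m → Mat m),
      (∀ ε > 0,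
        -- `u_ε ∈ W^{1,p}(Ω; ℝⁿ)` with `∇u_ε = G_ε`
        (∀ i, MemW1p Ω p (fun x => uε ε x i)) ∧
        HasWeakGradient Ω (uε ε) (Gε ε) ∧
        -- `∇u_ε ∈ SO(n)` a.e. on the stiff layers
        (∀ᵐ x ∂(volume.restrict (stiffLayers m lam ε ∩ Ω)),
          Gε ε x ∈ Matrix.specialOrthogonalGroup (Fin (m + 1)) ℝ) ∧
        -- `R_ε ∈ W^{1,p}(Ω; SO(n))` with `∇'R_ε = 0` and `∂_n R_ε = S_ε`
        (∀ i j, MemW1p Ω p (fun x => Rε ε x i j)) ∧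
        (∀ᵐ x ∂(volume.restrict Ω),
          Rε ε x ∈ Matrix.specialOrthogonalGroup (Fin (m + 1)) ℝ) ∧
        (∀ i j, ∀ k : Fin m,
          HasWeakPartial Ω k.castSucc (fun x => Rε ε x i j) (fun _ => 0)) ∧
        (∀ i j, HasWeakPartial Ω (Fin.last m) (fun x => Rε ε x i j) (fun x => Sε ε x i j)) ∧
        -- `∂_n R_ε = 0` and `∇u_ε = R_ε` a.e. on the stiff layers
        (∀ᵐ x ∂(volume.restrict (stiffLayers m lam ε ∩ Ω)), Sε ε x = 0) ∧
        (∀ᵐ x ∂(volume.restrict (stiffLayers m lam ε ∩ Ω)), Gε ε x = Rε ε x)) ∧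
      -- `u_ε ⇀ u` in `W^{1,p}(Ω; ℝⁿ)`
      (∀ i, WeakConvW1p Ω p (fun ε x => uε ε x i) (fun x => u x i)) ∧
      -- `∇u_ε ⇀ ∇u` in `L^p(Ω; ℝⁿˣⁿ)`
      (∀ i j, WeakConvLp Ω p (fun ε x => Gε ε x i j) (fun x => layeredField 1 R S d x i j)) ∧
      -- `R_ε ⇀ R` in `W^{1,p}(Ω; ℝⁿˣⁿ)`
      (∀ i j, WeakConvW1p Ω p (fun ε x => Rε ε x i j) (fun x => R x i j)) ∧
      -- `∇u_ε - (∇u)_λ → 0` in `L^p` on the soft layers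
      Tendsto (fun ε => eLpNorm (fun x => frobNorm (Gε ε x - layeredField lam⁻¹ R S d x)) p
        (volume.restrict (softLayers m lam ε ∩ Ω))) (𝓝[>] 0) (𝓝 0) := by
  have hp1' : 1 ≤ p := hp1.le
  have hp2' : p ≠ ⊤ := hp2.ne
  have hΩb := hΩ.isBounded
  have hΩm := hΩ.isOpen.measurableSet
  have hΩfin : volume Ω ≠ ⊤ := hΩb.measure_lt_top.ne
  obtain ⟨a, b, hab⟩ := exists_isHeightInterval hΩ hflat
  obtain ⟨P, σ, D, δ, hprof, hSO, hRP, hSσ, hdδ, huw⟩ :=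
    exists_isProfile hp1' hΩ hcross hab hu hR hRSO hR' hRn hd hd' hgrad
  have hΛ : 1 ≤ lam⁻¹ := (one_le_inv₀ hlam0).2 hlam1.le
  have hθ : ∀ ε > 0, IsLayerMap lam⁻¹ ε (softHeights lam ε) (layerMap lam ε) := fun ε hε =>
    isLayerMap_layerMap hlam0 hlam1 hε
  have hprofε := fun ε hε => hprof.comp hΛ (hθ ε hε)
  set Rε : ℝ → Space m → Mat m := fun ε x => P (layerMap lam ε (height x)) with hRε
  set Sε : ℝ → Space m → Mat m := fun ε x =>
    layerDeriv lam⁻¹ (softHeights lam ε) (layerMap lam ε) σ (height x) with hSε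
  set dε : ℝ → Space m → Space m := fun ε x =>
    layerDeriv lam⁻¹ (softHeights lam ε) (layerMap lam ε) δ (height x) with hdε
  set uε : ℝ → Space m → Space m := fun ε =>
    layerDeformation (P ∘ layerMap lam ε) (D ∘ layerMap lam ε) with huε
  set Gε : ℝ → Space m → Mat m := fun ε => layeredField 1 (Rε ε) (Sε ε) (dε ε) with hGε
  -- the limit fields coincide a.e. with those of the profile
  have hfield : ∀ c, layeredField c R S d =ᵐ[volume.restrict Ω] layeredField c
      (fun x => P (height x)) (fun x => σ (height x)) (fun x => δ (height x)) := by
    intro c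
    filter_upwards [hRP, hSσ, hdδ] with x h1 h2 h3
    simp only [layeredField, h1, h2, h3]
  have hfieldp : ∀ c i j, MemLp (fun x => layeredField c R S d x i j) p (volume.restrict Ω) := by
    intro c i j
    refine (hprof.memLp_layeredField hΩb hΩm c i j).ae_eq ?_
    filter_upwards [hfield c] with x hx
    rw [hx]
  have hGp : ∀ ε > 0, ∀ i j, MemLp (fun x => Gε ε x i j) p (volume.restrict Ω) := fun ε hε i j =>
    (hprofε ε hε).memLp_layeredField hΩb hΩm 1 i j
  have hGw : ∀ ε > 0, HasWeakGradient Ω (uε ε) (Gε ε) := fun ε hε =>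
    (hprofε ε hε).hasWeakGradient Ω
  -- off the soft heights both transversal terms vanish and only the rotation is left
  have hstiff : ∀ ε x, height x ∉ softHeights lam ε → Sε ε x = 0 ∧ Gε ε x = Rε ε x := by
    intro ε x hx
    have h1 : Sε ε x = 0 := indicator_of_notMem hx _
    have h2 : dε ε x = 0 := indicator_of_notMem hx _
    refine ⟨h1, ?_⟩
    ext i j
    simp only [hGε, layeredField_apply, h1, h2]
    simp
  -- measurability of the stiff layers is not needed: they lie over the measurable complement of the
  -- soft heights
  have hae : ∀ ε > 0, ∀ {Q : Space m → Prop}, (∀ x, height x ∉ softHeights lam ε → Q x) →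
      ∀ᵐ x ∂(volume.restrict (stiffLayers m lam ε ∩ Ω)), Q x := by
    intro ε hε Q hQ
    have hsub : stiffLayers m lam ε ∩ Ω ⊆ height ⁻¹' (softHeights lam ε)ᶜ := fun x hx =>
      height_notMem_softHeights hε hx.1
    exact ae_restrict_of_ae_restrict_of_subset hsub (ae_restrict_of_forall_mem
      (measurable_height (measurableSet_softHeights lam ε).compl) hQ)
  have huconv : ∀ i, WeakConvLp Ω p (fun ε x => uε ε x i) (fun x => u x i) := by
    intro i
    refine weakConvLp_of_tendsto_eLpNorm
      (fun ε hε => (hprofε ε hε).memLp_layerDeformation hΩb hΩm i) (hu i).1 ?_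
    refine (hprof.tendsto_eLpNorm_layerDeformation_comp_sub hp1' hΩb hΩm
      (fun ε hε => (hθ ε hε).abs_sub_le) (fun ε hε => (hθ ε hε).continuous) i).congr fun ε => ?_
    refine eLpNorm_congr_ae ?_
    filter_upwards [huw] with x hx
    simp only [Pi.sub_apply, hx, huε]
  -- bounded gradients of a strongly convergent family converge weakly, and the full family converges
  -- because the limit is identified as the weak gradient of `u`
  have hGconv : ∀ i j, WeakConvLp Ω p (fun ε x => Gε ε x i j)
      (fun x => layeredField 1 R S d x i j) := by
    intro i j
    obtain ⟨M, hM, hbound⟩ :=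
      hprof.exists_eLpNorm_layeredField_comp_le hp1' hp2' hSO hΩb hΩm hΛ i j
    refine weakConvLp_of_hasWeakPartial hΩ.isOpen hΩfin hp1 (huconv i) (fun ε hε => hGw ε hε i j)
      (hgrad i j) (fun ε hε => hGp ε hε i j) (hfieldp 1 i j) hM ?_
    filter_upwards [self_mem_nhdsWithin] with ε hε
    exact hbound (hθ ε hε)
  have hRconv : ∀ i j, WeakConvLp Ω p (fun ε x => Rε ε x i j) (fun x => R x i j) := by
    intro i j
    refine weakConvLp_of_tendsto_eLpNorm
      (fun ε hε => (hprofε ε hε).memLp_rot_height hΩb i j) (hR i j).1 ?_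
    refine (tendsto_eLpNorm_continuous_comp_layerMap_sub hΩb hΩm (hprof.continuous_rot i j)
      (fun ε hε => (hθ ε hε).abs_sub_le) (p := p)).congr fun ε => ?_
    refine eLpNorm_congr_ae ?_
    filter_upwards [hRP] with x hx
    simp only [Pi.sub_apply, hx, hRε]
  refine ⟨uε, Gε, Rε, Sε, fun ε hε => ⟨(hprofε ε hε).memW1p_layerDeformation hΩb hΩm, hGw ε hε,
    hae ε hε fun x hx => ?_, (hprofε ε hε).memW1p_rot hΩb,
    Eventually.of_forall fun x => hSO _, fun i j k => ?_, fun i j => ?_,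
    hae ε hε fun x hx => (hstiff ε x hx).1, hae ε hε fun x hx => (hstiff ε x hx).2⟩,
    fun i => ⟨huconv i, fun j => ⟨_, _, fun ε hε => hGw ε hε i j, hgrad i j, hGconv i j⟩⟩,
    hGconv, fun i j => ⟨hRconv i j, fun k => ?_⟩, ?_⟩
  · rw [(hstiff ε x hx).2]
    exact hSO _
  · simpa [Fin.castSucc_ne_last] using (hprofε ε hε).hasWeakPartial_rot Ω i j k.castSucc
  · simpa using (hprofε ε hε).hasWeakPartial_rot Ω i j (Fin.last m)
  · induction k using Fin.lastCases with
    | cast k =>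
      refine ⟨fun _ _ => 0, fun _ => 0, fun ε hε => ?_, hR' i j k, fun _ _ => MemLp.zero',
        MemLp.zero', fun q _ g _ => by simp⟩
      simpa [Fin.castSucc_ne_last] using (hprofε ε hε).hasWeakPartial_rot Ω i j k.castSucc
    | last =>
      have hSw : ∀ ε > 0, HasWeakPartial Ω (Fin.last m) (fun x => Rε ε x i j)
          (fun x => Sε ε x i j) := fun ε hε => by
        simpa using (hprofε ε hε).hasWeakPartial_rot Ω i j (Fin.last m)
      -- the bound comes from the change of variables under the layer map, pulled back to `Ω`
      obtain ⟨C, hC, hle⟩ := exists_map_height_le hΩb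
      refine ⟨fun ε x => Sε ε x i j, fun x => S x i j, hSw, hRn i j,
        weakConvLp_of_hasWeakPartial hΩ.isOpen hΩfin hp1 (hRconv i j) hSw (hRn i j)
          (fun ε hε => memLp_comp_height hΩb ((hprofε ε hε).memLp_rot i j)) ?_
          (M := C ^ (1 / p).toReal
            * (ENNReal.ofReal lam⁻¹ * eLpNorm (fun t => σ t i j) p volume)) ?_ ?_⟩
      · refine (memLp_comp_height hΩb (hprof.memLp_rot i j)).ae_eq ?_
        filter_upwards [hSσ] with x hx
        rw [hx]
      · exact ENNReal.mul_ne_top (ENNReal.rpow_ne_top_of_nonneg ENNReal.toReal_nonneg hC)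
          (ENNReal.mul_ne_top ENNReal.ofReal_ne_top (hprof.memLp_rot i j).eLpNorm_ne_top)
      · filter_upwards [self_mem_nhdsWithin] with ε hε
        simp only [hSε, layerDeriv_matrix_apply]
        exact ((hθ ε hε).eLpNorm_indicator_comp_height_le hΛ hle hp2' (hprof.memLp_rot i j)).2
  · have hentry : ∀ i j, Tendsto (fun ε => eLpNorm (fun x => Gε ε x i j
        - layeredField lam⁻¹ R S d x i j) p (volume.restrict (softLayers m lam ε ∩ Ω)))
        (𝓝[>] 0) (𝓝 0) := by
      intro i j
      refine (hprof.tendsto_eLpNorm_layeredField_comp_sub hp1' hp2' hΩb hΩm hΛ hθ i j).congr' ?_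
      filter_upwards [self_mem_nhdsWithin] with ε hε
      rw [softLayers_eq_preimage hε]
      refine eLpNorm_congr_ae ?_
      filter_upwards [ae_restrict_of_ae_restrict_of_subset inter_subset_right (hfield lam⁻¹)]
        with x hx
      simp only [hx, hGε, hRε, hSε, hdε]
    have hlim : Tendsto (fun ε => ∑ i, ∑ j, eLpNorm (fun x => Gε ε x i j
        - layeredField lam⁻¹ R S d x i j) p (volume.restrict (softLayers m lam ε ∩ Ω)))
        (𝓝[>] 0) (𝓝 0) := by
      simpa using tendsto_finsetSum Finset.univ fun i _ =>
        tendsto_finsetSum Finset.univ fun j _ => hentry i j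
    refine tendsto_of_tendsto_of_tendsto_of_le_of_le' tendsto_const_nhds hlim
      (Eventually.of_forall fun _ => zero_le) ?_
    filter_upwards [self_mem_nhdsWithin] with ε hε
    set μ := volume.restrict (softLayers m lam ε ∩ Ω) with hμ
    have hm : ∀ i j, AEStronglyMeasurable (fun x => Gε ε x i j
        - layeredField lam⁻¹ R S d x i j) μ := fun i j =>
      (((hGp ε hε i j).sub (hfieldp lam⁻¹ i j)).mono_measure
        (Measure.restrict_mono inter_subset_right le_rfl)).1
    exact eLpNorm_frobNorm_le hp1' hm
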